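/- Let $\varphi:[0,\infty)\to[0,\infty)$ be an Orlicz $N$-function, i.e. $\varphi$ is convex, $\varphi(0)=0$, $\varphi(t)>0$ for $t>0$, $\lim_{t\to0+}\varphi(t)/t=0$ and $\lim_{t\to\infty}\varphi(t)/t=\infty$. Let $\varphi_*(s)=\sup\{us-\varphi(u):u\ge 0\}$ be its complementary function and $q$ the right derivative of $\varphi_*$. For a measurable function $f$ on a measure space $(\Omega,\mu)$ let $f^*(t)=\inf\{\lambda>0:\mu\{|f|>\lambda\}\le t\}$ ($\inf\emptyset=\infty$) be its decreasing rearrangement; for a sequence $x=(x(i))_{i\ge1}$, $x^*(i)=\inf\{\lambda>0:|\{j:|x(j)|>\lambda\}|<i\}$. All integrals and sums below take values in $[0,\infty]$, and we put $\varphi(\infty)=\infty$. For $a,b\ge0$ the quotient $a/b$ is read as $0$ if $a=b=0$, and $\varphi_*(a/b)\,b$ is read as $0$ if $a=b=0$ and as $\infty$ if $a>0=b$. (1) Function case. Let $0<\gamma\le\infty$, $I=[0,\gamma)$ with Lebesgue measure, and let $w$ be a positive decreasing weight on $I$ (it may be unbounded near $0$) with $\int_0^t w<\infty$ for all $t\in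 I$, and $\int_0^\infty w=\infty$ if $\gamma=\infty$. Write $v\prec w$ if $\int_0^t v^*\le\int_0^t w^*$ for all $t\in I$, and put $$P_{\varphi_*,w}(h)=\inf\Big\{\int_I\varphi_*\Big(\frac{|h|}{v}\Big)v \;:\; v\ge0 \text{ measurable},\ v\prec w\Big\}.$$ Then for every non-negative simple function $h$ on $I$ whose support has finite measure there exists a non-negative simple function $v$ on $I$, with the same support $\{v\ne0\}=\{h\neq0\}$ as $h$, such that $$P_{\varphi_*,w}(h)=\int_I\varphi_*\Big(\frac hv\Big)v\qquad\text{and}\qquad \int_I\varphi\Big(q\Big(\frac hv\Big)\Big)v=\int_I\varphi\Big(q\Big(\frac hv\Big)^*\Big)w ,$$ where $q(h/v)^*$ is the decreasing rearrangement of the function $q(h/v)$. (2) Sequence case. Let $w=(w(i))_{i\ge1}$ be a positive decreasing sequence with $\sum_i w(i)=\infty$. Write $v\prec w$ if $\sum_{i=1}^n v^*(i)\le\sum_{i=1}^n w^*(i)$ for all $n$, and put $p_{\varphi_*,w}(x)=\inf\{\sum_i\varphi_*(|x(i)|/v(i))v(i): v\ge0,\ v\prec w\}$. Then for every real sequence $x$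 there exists a non-negative sequence $v$ with the same support as $x$ (so $v$ is finitely supported if $x$ is) such that $$p_{\varphi_*,w}(x)=\sum_{i}\varphi_*\Big(\frac{|x(i)|}{v(i)}\Big)v(i)\qquad\text{and}\qquad \sum_i\varphi\Big(q\Big(\frac{|x(i)|}{v(i)}\Big)\Big)v(i)=\sum_i\varphi\Big(q\Big(\frac{|x|}{v}\Big)^*(i)\Big)w(i),$$ as equalities in $[0,\infty]$. -/

import Mathlib

open MeasureTheory Set Filter Topology
open scoped ENNReal NNReal

noncomputable section

namespace OrliczLorentz

/-- An Orlicz `N`-function; only the values of `φ` on `[0, ∞)` matter. -/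
structure IsNFunction (φ : ℝ → ℝ) : Prop where
  convexOn : ConvexOn ℝ (Ici 0) φ
  map_zero : φ 0 = 0
  pos : ∀ t, 0 < t → 0 < φ t
  tendsto_zero : Tendsto (fun t => φ t / t) (𝓝[>] 0) (𝓝 0)
  tendsto_top : Tendsto (fun t => φ t / t) atTop atTop

/-- The complementary function `φ_*(s) = sup {u s - φ(u) : u ≥ 0}`
(a finite supremum when `φ` is an `N`-function). -/
def complementary (φ : ℝ → ℝ) (s : ℝ) : ℝ :=
  sSup ((fun u => u * s - φ u) '' Ici 0)

/-- The right derivative of a function. -/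
def rightDeriv (f : ℝ → ℝ) (t : ℝ) : ℝ := derivWithin f (Ioi t) t

/-- The function `t ↦ φ t` with values in `[0, ∞]`, extended by `φ ∞ = ∞`. -/
def extend (φ : ℝ → ℝ) (y : ℝ≥0∞) : ℝ≥0∞ :=
  if y = ∞ then ∞ else ENNReal.ofReal (φ y.toReal)

/-- The integrand `ψ(a / b) b` for `a, b ≥ 0`, with the conventions
`ψ(0 / 0) 0 = 0` and `ψ(a / 0) 0 = ∞` for `a > 0`. -/
def persp (ψ : ℝ → ℝ) (a b : ℝ) : ℝ≥0∞ :=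
  if b = 0 then (if a = 0 then 0 else ∞) else ENNReal.ofReal (ψ (a / b) * b)

/-- The distribution function `d_f(r) = μ {|f| > r}`. -/
def distribution {α : Type*} [MeasurableSpace α] (μ : Measure α) (f : α → ℝ) (r : ℝ≥0) : ℝ≥0∞ :=
  μ {x | (r : ℝ) < |f x|}

/-- The decreasing rearrangement `f^*(t) = inf {r > 0 : d_f(r) ≤ t}`, where `inf ∅ = ∞`.
For sequences (counting measure on `ℕ`, terms numbered from `0`), the term number `i` of the
rearrangement is `inf {r > 0 : d_f(r) < i + 1}`, that is, the value at `t = i`. -/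
def rearr {α : Type*} [MeasurableSpace α] (μ : Measure α) (f : α → ℝ) (t : ℝ≥0∞) : ℝ≥0∞ :=
  ⨅ (r : ℝ≥0) (_ : 0 < r ∧ distribution μ f r ≤ t), (r : ℝ≥0∞)

/-! Functions on an interval -/

/-- The interval `I = [0, γ)`, `0 < γ ≤ ∞`. -/
def interval (γ : ℝ≥0∞) : Set ℝ := {t | 0 ≤ t ∧ ENNReal.ofReal t < γ}

/-- Lebesgue measure on `I = [0, γ)`. -/
def leb (γ : ℝ≥0∞) : Measure ℝ := volume.restrict (interval γ)

/-- A weight on `I`: positive, decreasing (away from the single point `0`, so that it may be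
unbounded near `0`), with `W(t) = ∫_0^t w < ∞` for `t ∈ I`, and `W(∞) = ∞` if `γ = ∞`. -/
structure IsWeight (γ : ℝ≥0∞) (w : ℝ → ℝ) : Prop where
  pos : ∀ t ∈ interval γ, 0 < w t
  anti : AntitoneOn w (interval γ \ {0})
  finite : ∀ t ∈ interval γ, ∫⁻ s in Ioc 0 t, ENNReal.ofReal (w s) < ∞
  infinite : γ = ∞ → ∫⁻ s, ENNReal.ofReal (w s) ∂(leb γ) = ∞

/-- A simple function on `I`: Lebesgue measurable with finitely many values. -/
def IsSimple (γ : ℝ≥0∞) (f : ℝ → ℝ) : Prop :=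
  AEMeasurable f (leb γ) ∧ (f '' interval γ).Finite

/-- The Hardy–Littlewood(–Pólya) order `v ≺ w` on `I`. -/
def Submaj (γ : ℝ≥0∞) (v w : ℝ → ℝ) : Prop :=
  ∀ t ∈ interval γ, ∫⁻ s in Ioc 0 t, rearr (leb γ) v (ENNReal.ofReal s) ≤
    ∫⁻ s in Ioc 0 t, rearr (leb γ) w (ENNReal.ofReal s)

/-- `P_{ψ,w}(h) = inf {∫_I ψ(|h| / v) v : 0 ≤ v, v ≺ w}`. -/
def P (γ : ℝ≥0∞) (ψ w h : ℝ → ℝ) : ℝ≥0∞ :=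
  ⨅ (v : ℝ → ℝ) (_ : AEMeasurable v (leb γ) ∧ (∀ t ∈ interval γ, 0 ≤ v t) ∧ Submaj γ v w),
    ∫⁻ t, persp ψ |h t| (v t) ∂(leb γ)

/-! Sequences -/

/-- A weight sequence: positive, decreasing, with divergent sum. -/
structure IsSeqWeight (w : ℕ → ℝ) : Prop where
  pos : ∀ i, 0 < w i
  anti : Antitone w
  infinite : ∑' i, ENNReal.ofReal (w i) = ∞

/-- The order `v ≺ w` for sequences. -/
def SeqSubmaj (v w : ℕ → ℝ) : Prop :=
  ∀ n : ℕ, ∑ i ∈ Finset.range n, rearr Measure.count v (i : ℝ≥0∞) ≤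
    ∑ i ∈ Finset.range n, rearr Measure.count w (i : ℝ≥0∞)

/-- `p_{ψ,w}(x) = inf {∑ ψ(|x(i)| / v(i)) v(i) : 0 ≤ v, v ≺ w}`. -/
def seqP (ψ : ℝ → ℝ) (w x : ℕ → ℝ) : ℝ≥0∞ :=
  ⨅ (v : ℕ → ℝ) (_ : (∀ i, 0 ≤ v i) ∧ SeqSubmaj v w), ∑' i, persp ψ |x i| (v i)

end OrliczLorentz

end

/-!
Let `ψ = φ_*` and let `q` be its right derivative. The minimizer `v` is the inverse level function
of `w` with respect to `h`: arrange `h` decreasingly, form the least concave majorant of the curve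
`W ↦ H`, where `W` and `H` are the primitives of `w` and of the rearranged `h`, and let `r` be its
slope. Then `v = h / r`, and `h / v = r` is decreasing and constant on blocks, on each of which `v`
and `w` have the same mass.

Both equalities follow from the block structure. As `φ (q r)` is constant on blocks,
`∫ φ (q r) v = ∫ φ (q r)^* w`. As `φ (q r)` is decreasing and `u ≺ w`, the Hardy–Littlewood
inequality and summation by parts give `∫ φ (q r) u ≤ ∫ φ (q r)^* w` for every competitor `u`. Now
Young's inequality `ψ (h / u) u + φ (q r) u ≥ q r h` is an equality for `u = v`, so `v` is optimal.

Only finitely or countably many layers of `h` occur, so the argument reduces to sequences: `η k` and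
`ω k` are the masses of `h` and `w` on the `k`-th layer. `exists_isLevel` builds the slopes `r` from
successive steepest chords, `IsLevel.tsum_le_tsum` is the optimality and `IsLevel.tsum_mul_div_eq`
the equality of the two weighted integrals. Sums are compared at block ends only, where they are
finite, so that infinite values do no harm.

For sequences, a level sequence with finite blocks exists when the sums of the `n` largest terms of
`|x|` are `o(w 0 + ⋯ + w (n - 1))`. Otherwise Young's inequality gives `p(x) = ∞`, and all the sums
in question are infinite for `v = |x|`. For functions, `IsLevel.div_succ_le` and
`IsWeight.setLIntegral_step_le` show that `v ≺ w` between the ends of layers as well.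
-/

/-! ### Complementary functions and Young's inequality -/

namespace OrliczLorentz

lemma add_rightDeriv_mul_sub_le {S : Set ℝ} {f : ℝ → ℝ} (hf : ConvexOn ℝ S f) {x y : ℝ}
    (hx : x ∈ interior S) (hy : y ∈ S) : f x + rightDeriv f x * (y - x) ≤ f y := by
  have hxS : x ∈ S := interior_subset hx
  rcases lt_trichotomy x y with hxy | rfl | hxy
  · have h := hf.rightDeriv_le_slope_of_mem_interior hx hy hxy
    rw [slope_def_field, le_div_iff₀ (by linarith)] at h
    unfold rightDeriv; linarith
  · simp
  · have h := (hf.slope_le_leftDeriv_of_mem_interior hy hx hxy).trans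
      (hf.leftDeriv_le_rightDeriv_of_mem_interior hx)
    rw [slope_def_field, div_le_iff₀ (by linarith)] at h
    unfold rightDeriv; linarith

namespace IsNFunction

variable {φ : ℝ → ℝ}

lemma nonneg (hφ : IsNFunction φ) {u : ℝ} (hu : 0 ≤ u) : 0 ≤ φ u := by
  rcases hu.eq_or_lt with rfl | h
  · exact hφ.map_zero.ge
  · exact (hφ.pos u h).le

lemma bddAbove (hφ : IsNFunction φ) (s : ℝ) :
    BddAbove ((fun u => u * s - φ u) '' Ici 0) := by
  obtain ⟨M, hM⟩ := (hφ.tendsto_top.eventually_ge_atTop s).exists_forall_of_atTop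
  refine ⟨max M 1 * |s|, ?_⟩
  rintro _ ⟨u, hu, rfl⟩
  have hu : 0 ≤ u := hu
  have hφu := hφ.nonneg hu
  have hm1 : 1 ≤ max M 1 := le_max_right _ _
  rcases le_total u (max M 1) with h | h
  · have : u * s ≤ max M 1 * |s| :=
      (mul_le_mul_of_nonneg_left (le_abs_self s) hu).trans
        (mul_le_mul_of_nonneg_right h (abs_nonneg s))
    simp only; linarith
  · have hu0 : 0 < u := by linarith
    have := hM u ((le_max_left _ _).trans h)
    rw [le_div_iff₀ hu0] at this
    have : 0 ≤ max M 1 * |s| := by positivity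
    simp only; linarith

lemma young (hφ : IsNFunction φ) {u : ℝ} (hu : 0 ≤ u) (s : ℝ) :
    u * s ≤ φ u + complementary φ s := by
  have := le_csSup (hφ.bddAbove s) ⟨u, hu, rfl⟩
  simp only at this
  unfold complementary; linarith

lemma complementary_le {s b : ℝ} (h : ∀ u, 0 ≤ u → u * s ≤ φ u + b) :
    complementary φ s ≤ b := by
  refine csSup_le (Nonempty.image _ ⟨0, self_mem_Ici⟩) ?_
  rintro _ ⟨u, hu, rfl⟩
  have := h u hu
  simp only; linarith

lemma complementary_nonneg (hφ : IsNFunction φ) (s : ℝ) : 0 ≤ complementary φ s := by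
  have := hφ.young le_rfl s
  rw [hφ.map_zero] at this; linarith

lemma complementary_zero (hφ : IsNFunction φ) : complementary φ 0 = 0 :=
  le_antisymm (complementary_le fun u hu => by simpa using hφ.nonneg hu)
    (hφ.complementary_nonneg 0)

lemma exists_lt_mul (hφ : IsNFunction φ) {s : ℝ} (hs : 0 < s) : ∃ u, 0 < u ∧ φ u < u * s := by
  have h := (hφ.tendsto_zero.eventually_lt_const hs).and self_mem_nhdsWithin
  obtain ⟨u, hu, hu0⟩ := h.exists
  have hu0 : 0 < u := hu0
  exact ⟨u, hu0, by rwa [div_lt_iff₀ hu0, mul_comm] at hu⟩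

lemma complementary_pos (hφ : IsNFunction φ) {s : ℝ} (hs : 0 < s) : 0 < complementary φ s := by
  obtain ⟨u, hu0, hu⟩ := hφ.exists_lt_mul hs
  have := hφ.young hu0.le s
  linarith

lemma complementary_mono (hφ : IsNFunction φ) : Monotone (complementary φ) := by
  intro s t hst
  refine complementary_le fun u hu => ?_
  exact (mul_le_mul_of_nonneg_left hst hu).trans (hφ.young hu t)

lemma complementary_convexOn (hφ : IsNFunction φ) : ConvexOn ℝ univ (complementary φ) := by
  refine ⟨convex_univ, fun x _ y _ a b ha hb hab => complementary_le fun u hu => ?_⟩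
  have h1 := mul_le_mul_of_nonneg_left (hφ.young hu x) ha
  have h2 := mul_le_mul_of_nonneg_left (hφ.young hu y) hb
  have h3 : φ u = a * φ u + b * φ u := by rw [← add_mul, hab, one_mul]
  simp only [smul_eq_mul]
  linear_combination h1 + h2 - h3

lemma complementary_subgradient (hφ : IsNFunction φ) (s t : ℝ) :
    complementary φ s + rightDeriv (complementary φ) s * (t - s) ≤ complementary φ t :=
  add_rightDeriv_mul_sub_le hφ.complementary_convexOn (by simp) (mem_univ t)

lemma rightDeriv_nonneg (hφ : IsNFunction φ) (s : ℝ) :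
    0 ≤ rightDeriv (complementary φ) s := by
  have h1 := hφ.complementary_subgradient s (s - 1)
  have h2 := hφ.complementary_mono (show s - 1 ≤ s by linarith)
  linarith

lemma rightDeriv_mono (hφ : IsNFunction φ) : Monotone (rightDeriv (complementary φ)) := by
  intro s t hst
  rcases hst.eq_or_lt with rfl | hst
  · exact le_rfl
  have h1 := hφ.complementary_subgradient s t
  have h2 := hφ.complementary_subgradient t s
  have : (rightDeriv (complementary φ) s - rightDeriv (complementary φ) t) * (t - s) ≤ 0 := by
    linarith
  have := nonpos_of_mul_nonpos_left this (by linarith)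
  linarith

/-- A supporting line of `φ` at `u`; this is what makes `φ` its own biconjugate. -/
lemma exists_support (hφ : IsNFunction φ) {u : ℝ} (hu : 0 ≤ u) :
    ∃ m, ∀ x, 0 ≤ x → φ u + m * (x - u) ≤ φ x := by
  rcases hu.eq_or_lt with rfl | hu
  · exact ⟨0, fun x hx => by simpa [hφ.map_zero] using hφ.nonneg hx⟩
  · exact ⟨rightDeriv φ u, fun x hx => add_rightDeriv_mul_sub_le hφ.convexOn (by simpa using hu) hx⟩

/-- Equality in Young's inequality along `u = q(s)`. -/
lemma young_eq (hφ : IsNFunction φ) (s : ℝ) :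
    φ (rightDeriv (complementary φ) s) + complementary φ s =
      rightDeriv (complementary φ) s * s := by
  set q := rightDeriv (complementary φ) s
  have hq : 0 ≤ q := hφ.rightDeriv_nonneg s
  refine le_antisymm ?_ (hφ.young hq s)
  obtain ⟨m, hm⟩ := hφ.exists_support hq
  have h1 : complementary φ m ≤ m * q - φ q := complementary_le fun u hu => by
    have := hm u hu
    linarith
  have h2 := hφ.complementary_subgradient s m
  linarith

lemma rightDeriv_zero (hφ : IsNFunction φ) : rightDeriv (complementary φ) 0 = 0 := by
  by_contra hne
  have hq := (hφ.rightDeriv_nonneg 0).lt_of_ne' hne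
  have := hφ.young_eq 0
  rw [hφ.complementary_zero, mul_zero, add_zero] at this
  exact (hφ.pos _ hq).ne' this

lemma rightDeriv_pos (hφ : IsNFunction φ) {s : ℝ} (hs : 0 < s) :
    0 < rightDeriv (complementary φ) s := by
  refine (hφ.rightDeriv_nonneg s).lt_of_ne' fun h0 => ?_
  have := hφ.young_eq s
  rw [h0, hφ.map_zero, zero_mul, zero_add] at this
  exact (hφ.complementary_pos hs).ne' this

lemma mono (hφ : IsNFunction φ) {u v : ℝ} (hu : 0 ≤ u) (huv : u ≤ v) : φ u ≤ φ v := by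
  rcases hu.eq_or_lt with rfl | hu0
  · rw [hφ.map_zero]; exact hφ.nonneg huv
  have hv : 0 < v := hu0.trans_le huv
  have h := hφ.convexOn.2 (show (0 : ℝ) ∈ Ici 0 by simp) (show v ∈ Ici (0 : ℝ) from hv.le)
    (show 0 ≤ 1 - u / v by rw [sub_nonneg, div_le_one hv]; exact huv)
    (show 0 ≤ u / v by positivity) (by ring)
  simp only [smul_eq_mul, mul_zero, zero_add, hφ.map_zero, div_mul_cancel₀ _ hv.ne'] at h
  exact h.trans (mul_le_of_le_one_left (hφ.nonneg hv.le) (by rwa [div_le_one hv]))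

/-- Young's inequality for the integrand `φ_*(a / b) b`. -/
lemma young_persp (hφ : IsNFunction φ) {u a b : ℝ} (hu : 0 ≤ u) (hb : 0 ≤ b) :
    ENNReal.ofReal (u * a) ≤
      persp (complementary φ) a b + ENNReal.ofReal (φ u) * ENNReal.ofReal b := by
  unfold persp
  rcases hb.eq_or_lt with rfl | hb0
  · by_cases h : a = 0 <;> simp [h]
  · rw [if_neg hb0.ne', ← ENNReal.ofReal_mul (hφ.nonneg hu), ← ENNReal.ofReal_add
      (mul_nonneg (hφ.complementary_nonneg _) hb) (mul_nonneg (hφ.nonneg hu) hb)]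
    apply ENNReal.ofReal_le_ofReal
    have h := mul_le_mul_of_nonneg_right (hφ.young hu (a / b)) hb
    rw [mul_assoc, div_mul_cancel₀ _ hb0.ne'] at h
    linarith

end IsNFunction

lemma extend_ofReal {φ : ℝ → ℝ} {y : ℝ} (hy : 0 ≤ y) :
    extend φ (ENNReal.ofReal y) = ENNReal.ofReal (φ y) := by
  simp [extend, ENNReal.toReal_ofReal hy]

lemma persp_zero_zero (ψ : ℝ → ℝ) : persp ψ 0 0 = 0 := by simp [persp]

/-- On a layer where `a = h` and `b = h / r`, the integrand `φ_*(a / b) b` is `φ_*(r) b`. -/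
lemma persp_div (ψ : ℝ → ℝ) {a r : ℝ} (h : a = 0 ↔ r = 0) :
    persp ψ a (a / r) = ENNReal.ofReal (ψ r * (a / r)) := by
  by_cases ha : a = 0
  · simp [persp, ha]
  · have hr : r ≠ 0 := fun h0 => ha (h.2 h0)
    rw [persp, if_neg (div_ne_zero ha hr), div_div_cancel₀ ha]

end OrliczLorentz

/-! ### Level sequences -/

namespace OrliczLorentz

/-- `r` is a level sequence of `η` with respect to `ω`: the sequence of slopes of a concave
majorant of the points `(∑_{i<n} ω i, ∑_{i<n} η i)` that touches them at the end of every block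
of constancy of `r`. Then `η i / r i` is the inverse level sequence of `ω` with respect to `η`. -/
structure IsLevel (η ω r : ℕ → ℝ) : Prop where
  anti : Antitone r
  nonneg : ∀ i, 0 ≤ r i
  eq_zero_iff : ∀ i, r i = 0 ↔ η i = 0
  sum_div_le : ∀ n, ∑ i ∈ Finset.range n, η i / r i ≤ ∑ i ∈ Finset.range n, ω i
  /-- The masses of `η` and `r ω` agree on each block, hence up to arbitrarily late indices. -/
  exists_sum_eq : ∀ m, ∃ N, m ≤ N ∧ ∀ G : ℝ → ℝ,
    ∑ i ∈ Finset.range N, G (r i) * η i = ∑ i ∈ Finset.range N, G (r i) * (r i * ω i)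
  /-- At the end of a block, `η / r` crosses `ω` downwards. -/
  succ_eq_or : ∀ i, r (i + 1) = r i ∨ (r i * ω i ≤ η i ∧ η (i + 1) ≤ r (i + 1) * ω (i + 1))

/-- From each point there is a steepest chord to the right, provided the points
`(W n, H n)` grow sublinearly. -/
lemma exists_steepest_chord {η ω : ℕ → ℝ} (hη : ∀ i, 0 ≤ η i)
    (hη0 : ∀ i j, i ≤ j → η i = 0 → η j = 0) (hω : ∀ i, 0 < ω i)
    (hW : Tendsto (fun n => ∑ i ∈ Finset.range n, ω i) atTop atTop)
    (hlim : ∀ c > 0, ∀ᶠ n in atTop,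
      ∑ i ∈ Finset.range n, η i ≤ c * ∑ i ∈ Finset.range n, ω i) (a : ℕ) :
    ∃ b, a < b ∧ ∀ k, a ≤ k →
      (∑ i ∈ Finset.Ico a k, η i) * ∑ i ∈ Finset.Ico a b, ω i ≤
        (∑ i ∈ Finset.Ico a b, η i) * ∑ i ∈ Finset.Ico a k, ω i := by
  have hWpos : ∀ b, a < b → 0 < ∑ i ∈ Finset.Ico a b, ω i := fun b hb =>
    Finset.sum_pos (fun i _ => hω i) (by simpa using hb)
  by_cases ha : η a = 0
  · refine ⟨a + 1, by omega, fun k hk => ?_⟩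
    rw [Finset.sum_eq_zero fun i hi => hη0 a i (Finset.mem_Ico.1 hi).1 ha,
      Finset.sum_eq_zero fun i hi => hη0 a i (Finset.mem_Ico.1 hi).1 ha]
    simp
  have hρ : 0 < η a / ω a := div_pos ((hη a).lt_of_ne' ha) (hω a)
  set ρ := η a / ω a with hρdef
  obtain ⟨K, hK⟩ := ((hlim (ρ / 2) (by positivity)).and
    (hW.eventually_ge_atTop (2 * ∑ i ∈ Finset.range a, ω i))).exists_forall_of_atTop
  set S : ℕ → ℝ := fun k => (∑ i ∈ Finset.Ico a k, η i) / ∑ i ∈ Finset.Ico a k, ω i with hS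
  obtain ⟨b, hb, hmax⟩ := Finset.exists_max_image (Finset.Icc (a + 1) (max K (a + 1))) S
    ⟨a + 1, by simp⟩
  have hab : a < b := by have := (Finset.mem_Icc.1 hb).1; omega
  have hSb : ρ ≤ S b := by
    have := hmax (a + 1) (by simp)
    simpa [hS, hρdef] using this
  refine ⟨b, hab, fun k hk => ?_⟩
  rcases hk.eq_or_lt with rfl | hk
  · simp
  have hSk : S k ≤ S b := by
    rcases le_total k (max K (a + 1)) with h | h
    · exact hmax k (Finset.mem_Icc.2 ⟨hk, h⟩)
    · refine le_trans ?_ hSb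
      obtain ⟨h1, h2⟩ := hK k ((le_max_left _ _).trans h)
      rw [hS, div_le_iff₀ (hWpos k hk)]
      have e1 := Finset.sum_range_add_sum_Ico η hk.le
      have e2 := Finset.sum_range_add_sum_Ico ω hk.le
      have h3 : 0 ≤ ∑ i ∈ Finset.range a, η i := Finset.sum_nonneg fun i _ => hη i
      nlinarith
  rw [hS] at hSk
  exact (div_le_div_iff₀ (hWpos k hk) (hWpos b hab)).1 hSk

/-- Existence of level sequences: the blocks are found by following steepest chords. -/
lemma exists_isLevel {η ω : ℕ → ℝ} (hη : ∀ i, 0 ≤ η i)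
    (hη0 : ∀ i j, i ≤ j → η i = 0 → η j = 0) (hω : ∀ i, 0 < ω i)
    (hW : Tendsto (fun n => ∑ i ∈ Finset.range n, ω i) atTop atTop)
    (hlim : ∀ c > 0, ∀ᶠ n in atTop,
      ∑ i ∈ Finset.range n, η i ≤ c * ∑ i ∈ Finset.range n, ω i) :
    ∃ r, IsLevel η ω r := by
  choose nxt hnxt hmax using exists_steepest_chord hη hη0 hω hW hlim
  -- the block ends `N j` and the slopes `R j` of the chords between them
  set N : ℕ → ℕ := fun j => nxt^[j] 0 with hN
  have hNs : ∀ j, N (j + 1) = nxt (N j) := fun j => Function.iterate_succ_apply' nxt j 0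
  have hNlt : ∀ j, N j < N (j + 1) := fun j => by rw [hNs]; exact hnxt _
  have hNmono : StrictMono N := strictMono_nat_of_lt_succ hNlt
  have hWpos : ∀ a b : ℕ, a < b → 0 < ∑ i ∈ Finset.Ico a b, ω i := fun a b hb =>
    Finset.sum_pos (fun i _ => hω i) (by simpa using hb)
  set R : ℕ → ℝ := fun j =>
    (∑ i ∈ Finset.Ico (N j) (N (j + 1)), η i) / ∑ i ∈ Finset.Ico (N j) (N (j + 1)), ω i with hR
  have hRsum : ∀ j, ∑ i ∈ Finset.Ico (N j) (N (j + 1)), η i =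
      R j * ∑ i ∈ Finset.Ico (N j) (N (j + 1)), ω i := fun j =>
    (div_mul_cancel₀ _ (hWpos _ _ (hNlt j)).ne').symm
  have hRle : ∀ j k, N j ≤ k → ∑ i ∈ Finset.Ico (N j) k, η i ≤
      R j * ∑ i ∈ Finset.Ico (N j) k, ω i := fun j k hk => by
    have h := hmax (N j) k hk
    rw [← hNs, hRsum] at h
    have hp := hWpos _ _ (hNlt j)
    refine le_of_mul_le_mul_right ?_ hp
    linarith
  have hR0 : ∀ j, 0 ≤ R j := fun j =>
    div_nonneg (Finset.sum_nonneg fun i _ => hη i) (hWpos _ _ (hNlt j)).le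
  have hRanti : Antitone R := antitone_nat_of_succ_le fun j => by
    have h := hRle j (N (j + 2)) (hNmono.monotone (by omega))
    rw [← Finset.sum_Ico_consecutive η (hNlt j).le (hNlt (j + 1)).le,
      ← Finset.sum_Ico_consecutive ω (hNlt j).le (hNlt (j + 1)).le, hRsum, hRsum, mul_add] at h
    exact le_of_mul_le_mul_right (by linarith) (hWpos _ _ (hNlt (j + 1)))
  have hblk : ∀ i, ∃ j, N j ≤ i ∧ i < N (j + 1) := fun i => by
    have hex : ∃ j, i < N j := ⟨i + 1, Nat.lt_of_succ_le (hNmono.le_apply)⟩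
    obtain ⟨j, hj⟩ : ∃ j, Nat.find hex = j + 1 :=
      Nat.exists_eq_succ_of_ne_zero fun h0 => by
        have := Nat.find_spec hex
        rw [h0] at this
        simp [hN] at this
    refine ⟨j, not_lt.1 (Nat.find_min hex (by omega)), ?_⟩
    rw [← hj]; exact Nat.find_spec hex
  choose blk hblk1 hblk2 using hblk
  have hblkmono : Monotone blk := fun i k hik => by
    have h : N (blk i) < N (blk k + 1) := ((hblk1 i).trans hik).trans_lt (hblk2 k)
    have := hNmono.lt_iff_lt.1 h
    omega
  have hblkeq : ∀ i j, N j ≤ i → i < N (j + 1) → blk i = j := fun i j h1 h2 => by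
    have h3 := hNmono.lt_iff_lt.1 ((hblk1 i).trans_lt h2)
    have h4 := hNmono.lt_iff_lt.1 (h1.trans_lt (hblk2 i))
    omega
  have hends : ∀ (G : ℝ → ℝ) j, ∑ i ∈ Finset.range (N j), G (R (blk i)) * η i =
      ∑ i ∈ Finset.range (N j), G (R (blk i)) * (R (blk i) * ω i) := fun G j => by
    induction j with
    | zero => simp [hN]
    | succ j ih =>
      rw [← Finset.sum_range_add_sum_Ico _ (hNlt j).le, ih,
        ← Finset.sum_range_add_sum_Ico _ (hNlt j).le]
      congr 1
      have hb : ∀ i ∈ Finset.Ico (N j) (N (j + 1)), blk i = j := fun i hi =>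
        hblkeq i j (Finset.mem_Ico.1 hi).1 (Finset.mem_Ico.1 hi).2
      rw [Finset.sum_congr rfl fun i hi => by rw [hb i hi], ← Finset.mul_sum, hRsum,
        Finset.mul_sum, Finset.mul_sum]
      exact Finset.sum_congr rfl fun i hi => by rw [hb i hi]
  refine ⟨fun i => R (blk i), hRanti.comp_monotone hblkmono, fun i => hR0 _, fun i => ?_,
    fun n => ?_, fun m => ⟨N m, hNmono.le_apply, fun G => hends G m⟩, fun i => ?_⟩
  · constructor
    · intro h
      have hs := hRsum (blk i)
      rw [h, zero_mul, Finset.sum_eq_zero_iff_of_nonneg fun k _ => hη k] at hs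
      exact hs i (Finset.mem_Ico.2 ⟨hblk1 i, hblk2 i⟩)
    · intro h
      have h1 := hRle (blk i) i (hblk1 i)
      have h2 := hRsum (blk i)
      have hz : ∑ k ∈ Finset.Ico i (N (blk i + 1)), η k = 0 :=
        Finset.sum_eq_zero fun k hk => hη0 i k (Finset.mem_Ico.1 hk).1 h
      rw [← Finset.sum_Ico_consecutive η (hblk1 i) (hblk2 i).le,
        ← Finset.sum_Ico_consecutive ω (hblk1 i) (hblk2 i).le, hz, add_zero] at h2
      have h3 : R (blk i) * ∑ k ∈ Finset.Ico i (N (blk i + 1)), ω k ≤ 0 := by linarith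
      exact le_antisymm (nonpos_of_mul_nonpos_left h3 (hWpos _ _ (hblk2 i))) (hR0 _)
  · have hj1 := hblk1 n
    have hj2 := hblk2 n
    rw [← Finset.sum_range_add_sum_Ico _ hj1, ← Finset.sum_range_add_sum_Ico ω hj1]
    have hb : ∀ i ∈ Finset.Ico (N (blk n)) n, blk i = blk n := fun i hi =>
      hblkeq i _ (Finset.mem_Ico.1 hi).1 ((Finset.mem_Ico.1 hi).2.trans hj2)
    refine add_le_add ?_ ?_
    · have h := hends (fun x => x⁻¹) (blk n)
      simp only [inv_mul_eq_div] at h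
      rw [h]
      refine Finset.sum_le_sum fun i _ => ?_
      rcases (hR0 (blk i)).eq_or_lt with h0 | h0
      · rw [← h0]; simpa using (hω i).le
      · rw [mul_div_cancel_left₀ _ h0.ne']
    · rw [Finset.sum_congr rfl fun i hi => by rw [hb i hi], ← Finset.sum_div]
      rcases (hR0 (blk n)).eq_or_lt with h0 | h0
      · rw [← h0, div_zero]; exact Finset.sum_nonneg fun i _ => (hω i).le
      · rw [div_le_iff₀ h0, mul_comm]; exact hRle _ _ hj1
  · rcases (show i + 1 ≤ N (blk i + 1) from hblk2 i).lt_or_eq with h | h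
    · left
      rw [hblkeq (i + 1) (blk i) ((hblk1 i).trans (Nat.le_succ i)) h]
    · right
      have hb : blk (i + 1) = blk i + 1 := hblkeq _ _ h.ge (h ▸ hNlt _)
      constructor
      · have h1 := hRle (blk i) i (hblk1 i)
        have h2 := hRsum (blk i)
        rw [← h, Finset.sum_Ico_succ_top (hblk1 i), Finset.sum_Ico_succ_top (hblk1 i)] at h2
        linarith
      · have h1 := hRle (blk i + 1) (i + 2) (by omega)
        rw [← h] at h1
        simpa [hb] using h1

end OrliczLorentz

/-! ### Optimality of the inverse level sequence -/

namespace OrliczLorentz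

lemma sum_mul_le_sum_mul_of_antitone {F u ω : ℕ → ℝ} (hF : Antitone F) (hF0 : ∀ i, 0 ≤ F i)
    (h : ∀ n, ∑ i ∈ Finset.range n, u i ≤ ∑ i ∈ Finset.range n, ω i) (n : ℕ) :
    ∑ i ∈ Finset.range n, F i * u i ≤ ∑ i ∈ Finset.range n, F i * ω i := by
  have key : F n * (∑ i ∈ Finset.range n, ω i - ∑ i ∈ Finset.range n, u i) ≤
      ∑ i ∈ Finset.range n, F i * ω i - ∑ i ∈ Finset.range n, F i * u i := by
    induction n with
    | zero => simp
    | succ n ih =>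
      have h1 := mul_le_mul_of_nonneg_right (hF (Nat.le_succ n)) (sub_nonneg.2 (h (n + 1)))
      simp only [Finset.sum_range_succ] at h1 ⊢
      nlinarith
  have := mul_nonneg (hF0 n) (sub_nonneg.2 (h n))
  linarith

lemma tsum_le_tsum_of_frequently_sum_le {f g : ℕ → ℝ≥0∞}
    (h : ∀ m, ∃ N, m ≤ N ∧ ∑ i ∈ Finset.range N, f i ≤ ∑ i ∈ Finset.range N, g i) :
    ∑' i, f i ≤ ∑' i, g i := by
  rw [ENNReal.tsum_eq_iSup_nat]
  refine iSup_le fun m => ?_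
  obtain ⟨N, hN, hle⟩ := h m
  calc ∑ i ∈ Finset.range m, f i ≤ ∑ i ∈ Finset.range N, f i :=
        Finset.sum_le_sum_of_subset (Finset.range_mono hN)
    _ ≤ _ := hle
    _ ≤ _ := ENNReal.sum_le_tsum _

namespace IsLevel

variable {η ω r : ℕ → ℝ}

lemma sum_mul_div_eq (hr : IsLevel η ω r) (m : ℕ) : ∃ N, m ≤ N ∧ ∀ G : ℝ → ℝ, G 0 = 0 →
    ∑ i ∈ Finset.range N, G (r i) * (η i / r i) = ∑ i ∈ Finset.range N, G (r i) * ω i := by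
  obtain ⟨N, hN, h⟩ := hr.exists_sum_eq m
  refine ⟨N, hN, fun G hG => ?_⟩
  have h1 := h fun x => G x / x
  have e1 : ∀ i ∈ Finset.range N, G (r i) * (η i / r i) = G (r i) / r i * η i := fun i _ => by
    ring
  have e2 : ∀ i ∈ Finset.range N, G (r i) * ω i = G (r i) / r i * (r i * ω i) := fun i _ => by
    by_cases h0 : r i = 0
    · simp [h0, hG]
    · field_simp
  rw [Finset.sum_congr rfl e1, Finset.sum_congr rfl e2, h1]

/-- The equality `∫ φ (q (h / v)) v = ∫ φ (q (h / v)^*) w`, with `G = φ ∘ q`, after integration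
over the layers. -/
lemma tsum_mul_div_eq (hr : IsLevel η ω r) (hη : ∀ i, 0 ≤ η i) (hω : ∀ i, 0 ≤ ω i)
    {G : ℝ → ℝ} (hG : G 0 = 0) (hG0 : ∀ x, 0 ≤ G x) :
    ∑' i, ENNReal.ofReal (G (r i) * (η i / r i)) = ∑' i, ENNReal.ofReal (G (r i) * ω i) := by
  have key : ∀ m, ∃ N, m ≤ N ∧ ∑ i ∈ Finset.range N, ENNReal.ofReal (G (r i) * (η i / r i)) =
      ∑ i ∈ Finset.range N, ENNReal.ofReal (G (r i) * ω i) := fun m => by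
    obtain ⟨N, hN, h⟩ := hr.sum_mul_div_eq m
    refine ⟨N, hN, ?_⟩
    rw [← ENNReal.ofReal_sum_of_nonneg fun i _ =>
        mul_nonneg (hG0 _) (div_nonneg (hη i) (hr.nonneg i)),
      ← ENNReal.ofReal_sum_of_nonneg fun i _ => mul_nonneg (hG0 _) (hω i), h G hG]
  refine le_antisymm (tsum_le_tsum_of_frequently_sum_le fun m => ?_)
    (tsum_le_tsum_of_frequently_sum_le fun m => ?_)
  · obtain ⟨N, hN, h⟩ := key m
    exact ⟨N, hN, h.le⟩
  · obtain ⟨N, hN, h⟩ := key m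
    exact ⟨N, hN, h.ge⟩

/-- Optimality of `η / r`. Here `u i` and `p i` are the integrals over the `i`-th layer of a
competitor and of the corresponding integrand `φ_*(η / u) u`. Young's inequality with `t = q(r i)`
is an equality for `η / r`; the term `∑ φ(q(r i)) u i` is largest for `η / r` because `φ(q(r))` is
decreasing. The comparison is made at block ends only, where all sums are finite. -/
lemma tsum_le_tsum (hr : IsLevel η ω r) {φ : ℝ → ℝ} (hφ : IsNFunction φ)
    (hη : ∀ i, 0 ≤ η i) (hω : ∀ i, 0 ≤ ω i) {p u : ℕ → ℝ≥0∞}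
    (hu : ∀ n, ∑ i ∈ Finset.range n, u i ≤ ENNReal.ofReal (∑ i ∈ Finset.range n, ω i))
    (hp : ∀ t, 0 ≤ t → ∀ i, ENNReal.ofReal (t * η i) ≤ p i + ENNReal.ofReal (φ t) * u i) :
    ∑' i, ENNReal.ofReal (complementary φ (r i) * (η i / r i)) ≤ ∑' i, p i := by
  refine tsum_le_tsum_of_frequently_sum_le fun m => ?_
  obtain ⟨N, hN, h⟩ := hr.sum_mul_div_eq m
  refine ⟨N, hN, ?_⟩
  set ψ := complementary φ
  set q := rightDeriv ψ with hq
  have hq0 : ∀ s, 0 ≤ q s := hφ.rightDeriv_nonneg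
  have hF0 : ∀ i, 0 ≤ φ (q (r i)) := fun i => hφ.nonneg (hq0 _)
  have hFanti : Antitone fun i => φ (q (r i)) := fun i j hij =>
    hφ.mono (hq0 _) (hφ.rightDeriv_mono (hr.anti hij))
  have hufin : ∀ i, u i ≠ ∞ := fun i => by
    refine ne_top_of_le_ne_top ENNReal.ofReal_ne_top ((le_trans ?_ (hu (i + 1))))
    rw [Finset.sum_range_succ]; exact le_add_self
  have hA : ∑ i ∈ Finset.range N, ENNReal.ofReal (φ (q (r i))) * u i ≤
      ENNReal.ofReal (∑ i ∈ Finset.range N, φ (q (r i)) * ω i) := by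
    have e : ∀ i ∈ Finset.range N, ENNReal.ofReal (φ (q (r i))) * u i =
        ENNReal.ofReal (φ (q (r i)) * (u i).toReal) := fun i _ => by
      rw [ENNReal.ofReal_mul (hF0 i), ENNReal.ofReal_toReal (hufin i)]
    rw [Finset.sum_congr rfl e, ← ENNReal.ofReal_sum_of_nonneg fun i _ =>
      mul_nonneg (hF0 i) ENNReal.toReal_nonneg]
    refine ENNReal.ofReal_le_ofReal (sum_mul_le_sum_mul_of_antitone hFanti hF0 (fun n => ?_) N)
    rw [← ENNReal.toReal_sum fun i _ => hufin i]
    exact ENNReal.toReal_le_of_le_ofReal (Finset.sum_nonneg fun i _ => hω i) (hu n)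
  have hφq : φ (q 0) = 0 := by rw [hq, hφ.rightDeriv_zero, hφ.map_zero]
  have hψr : ∀ i, 0 ≤ ψ (r i) * (η i / r i) := fun i =>
    mul_nonneg (hφ.complementary_nonneg _) (div_nonneg (hη i) (hr.nonneg i))
  have hB : ENNReal.ofReal (∑ i ∈ Finset.range N, ψ (r i) * (η i / r i)) +
      ENNReal.ofReal (∑ i ∈ Finset.range N, φ (q (r i)) * ω i) =
      ∑ i ∈ Finset.range N, ENNReal.ofReal (q (r i) * η i) := by
    rw [← ENNReal.ofReal_add (Finset.sum_nonneg fun i _ => hψr i)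
      (Finset.sum_nonneg fun i _ => mul_nonneg (hF0 i) (hω i)),
      ← ENNReal.ofReal_sum_of_nonneg fun i _ => mul_nonneg (hq0 _) (hη i),
      ← h (fun x => φ (q x)) hφq, ← Finset.sum_add_distrib]
    congr 1
    refine Finset.sum_congr rfl fun i _ => ?_
    by_cases h0 : r i = 0
    · rw [h0, (hr.eq_zero_iff i).1 h0]; simp
    · have := hφ.young_eq (r i)
      rw [← add_mul, add_comm (ψ (r i)), this]
      field_simp
      exact mul_comm _ _
  rw [← ENNReal.ofReal_sum_of_nonneg fun i _ => hψr i]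
  refine ENNReal.le_of_add_le_add_right
    (a := ENNReal.ofReal (∑ i ∈ Finset.range N, φ (q (r i)) * ω i)) ENNReal.ofReal_ne_top ?_
  calc _ = _ := hB
    _ ≤ ∑ i ∈ Finset.range N, (p i + ENNReal.ofReal (φ (q (r i))) * u i) :=
      Finset.sum_le_sum fun i _ => hp _ (hq0 _) i
    _ = _ := Finset.sum_add_distrib
    _ ≤ _ := by gcongr

/-- The inverse level function is decreasing: with layers of size `a i` on which `η` has the
decreasing density `c i`, its density `c i / r i` decreases when `ω` has decreasing averages. -/
lemma div_succ_le (hr : IsLevel η ω r) {a c : ℕ → ℝ} (hη : ∀ i, η i = c i * a i) {i : ℕ}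
    (hc0 : 0 ≤ c i) (hc : c (i + 1) ≤ c i) (hai : 0 < a i) (hai' : 0 < a (i + 1))
    (hω : ω (i + 1) / a (i + 1) ≤ ω i / a i) :
    c (i + 1) / r (i + 1) ≤ c i / r i := by
  rcases hr.succ_eq_or i with h | ⟨h1, h2⟩
  · rw [h]; exact div_le_div_of_nonneg_right hc (hr.nonneg i)
  rcases (hr.nonneg (i + 1)).eq_or_lt with h0 | h0
  · rw [← h0, div_zero]; exact div_nonneg hc0 (hr.nonneg i)
  have hri : 0 < r i := h0.trans_le (hr.anti (Nat.le_succ i))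
  calc c (i + 1) / r (i + 1) ≤ ω (i + 1) / a (i + 1) := by
        rw [div_le_div_iff₀ h0 hai', ← hη, mul_comm]; linarith
    _ ≤ ω i / a i := hω
    _ ≤ c i / r i := by rw [div_le_div_iff₀ hai hri, ← hη, mul_comm]; exact h1

end IsLevel

end OrliczLorentz

/-! ### Decreasing rearrangements -/

namespace OrliczLorentz

section Rearrangement

variable {α : Type*} [MeasurableSpace α] {μ : Measure α} {f : α → ℝ}

lemma distribution_anti : Antitone (distribution μ f) := fun _ _ h =>
  measure_mono fun _ hx => (NNReal.coe_le_coe.2 h).trans_lt hx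

lemma le_rearr {c : ℝ} {t : ℝ≥0∞}
    (h : ∀ r : ℝ≥0, 0 < r → (r : ℝ) < c → t < distribution μ f r) :
    ENNReal.ofReal c ≤ rearr μ f t := by
  refine le_iInf₂ fun r hr => ?_
  by_contra hlt
  have : (r : ℝ) < c := by
    rw [not_le, ← ENNReal.ofReal_coe_nnreal] at hlt
    exact (ENNReal.ofReal_lt_ofReal_iff_of_nonneg r.2).1 hlt
  exact (h r hr.1 this).not_ge hr.2

lemma rearr_le {c : ℝ} {t : ℝ≥0∞}
    (h : ∀ r : ℝ≥0, 0 < r → c < r → distribution μ f r ≤ t) :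
    rearr μ f t ≤ ENNReal.ofReal c := by
  refine le_of_forall_gt_imp_ge_of_dense fun a ha => ?_
  rcases eq_or_ne a ∞ with rfl | hat
  · exact le_top
  lift a to ℝ≥0 using hat
  rw [← ENNReal.ofReal_coe_nnreal] at ha ⊢
  have hc : c < a := not_le.1 fun hle => (ENNReal.ofReal_le_ofReal hle).not_gt ha
  have ha0 : 0 < a := by
    have := pos_of_gt ha
    simpa using this
  rw [ENNReal.ofReal_coe_nnreal]
  exact iInf₂_le a ⟨ha0, h a ha0 hc⟩

end Rearrangement

/-! ### Rearrangements of sequences -/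

/-- The Hardy–Littlewood inequality for sums over finite sets. -/
lemma sum_le_sum_rearr (v : ℕ → ℝ) (S : Finset ℕ) :
    ∑ j ∈ S, ENNReal.ofReal (v j) ≤
      ∑ i ∈ Finset.range S.card, rearr Measure.count v (i : ℝ≥0∞) := by
  induction hn : S.card generalizing S with
  | zero => simp [Finset.card_eq_zero.1 hn]
  | succ n ih =>
    -- remove the smallest term: all `n + 1` terms are at least as large
    obtain ⟨j, hj, hmin⟩ := S.exists_min_image v (Finset.card_pos.1 (by omega))
    rw [← Finset.sum_erase_add _ _ hj, Finset.sum_range_succ]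
    refine add_le_add (ih _ (by rw [Finset.card_erase_of_mem hj, hn]; rfl)) (le_rearr ?_)
    intro r _ hrj
    calc (n : ℝ≥0∞) < (S.card : ℝ≥0∞) := by rw [hn]; exact_mod_cast Nat.lt_succ_self n
      _ = Measure.count (S : Set ℕ) := (Measure.count_apply_finset S).symm
      _ ≤ _ := measure_mono fun i hi =>
        (hrj.trans_le (hmin i hi)).trans_le (le_abs_self _)

lemma rearr_count_of_injective {σ : ℕ → ℕ} (hσ : Function.Injective σ) {g : ℕ → ℝ}
    (hg : ∀ j, 0 ≤ g j) (hanti : Antitone fun i => g (σ i)) (h0 : ∀ j ∉ range σ, g j = 0)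
    (i : ℕ) : rearr Measure.count g (i : ℝ≥0∞) = ENNReal.ofReal (g (σ i)) := by
  refine le_antisymm (rearr_le fun r hr hlt => ?_) (le_rearr fun r _ hlt => ?_)
  · calc distribution Measure.count g r ≤
          Measure.count (((Finset.range i).image σ : Finset ℕ) : Set ℕ) := by
          refine measure_mono fun j hj => ?_
          have hj : (r : ℝ) < |g j| := hj
          rw [abs_of_nonneg (hg j)] at hj
          by_cases hjr : j ∈ range σ
          · obtain ⟨k, rfl⟩ := hjr
            have hk : k < i := by
              by_contra hle
              have : g (σ k) ≤ g (σ i) := hanti (not_lt.1 hle)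
              linarith
            simpa using ⟨k, hk, rfl⟩
          · rw [h0 j hjr] at hj
            exact absurd hj (not_lt.2 r.2)
      _ = i := by
          rw [Measure.count_apply_finset, Finset.card_image_of_injective _ hσ, Finset.card_range]
  · calc (i : ℝ≥0∞) < ((i + 1 : ℕ) : ℝ≥0∞) := by exact_mod_cast Nat.lt_succ_self i
      _ = Measure.count (((Finset.range (i + 1)).image σ : Finset ℕ) : Set ℕ) := by
          rw [Measure.count_apply_finset, Finset.card_image_of_injective _ hσ, Finset.card_range]
      _ ≤ _ := by
          refine measure_mono fun j hj => ?_
          obtain ⟨k, hk, rfl⟩ := Finset.mem_image.1 (Finset.mem_coe.1 hj)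
          have : g (σ i) ≤ g (σ k) := hanti (by have := Finset.mem_range.1 hk; omega)
          exact (hlt.trans_le this).trans_le (le_abs_self _)

lemma IsSeqWeight.rearr_eq {w : ℕ → ℝ} (hw : IsSeqWeight w) (i : ℕ) :
    rearr Measure.count w (i : ℝ≥0∞) = ENNReal.ofReal (w i) :=
  rearr_count_of_injective Function.injective_id (fun j => (hw.pos j).le) hw.anti (by simp) i

lemma IsSeqWeight.sum_rearr {w : ℕ → ℝ} (hw : IsSeqWeight w) (n : ℕ) :
    ∑ i ∈ Finset.range n, rearr Measure.count w (i : ℝ≥0∞) =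
      ENNReal.ofReal (∑ i ∈ Finset.range n, w i) := by
  rw [ENNReal.ofReal_sum_of_nonneg fun i _ => (hw.pos i).le]
  exact Finset.sum_congr rfl fun i _ => hw.rearr_eq i

lemma IsSeqWeight.tendsto_sum {w : ℕ → ℝ} (hw : IsSeqWeight w) :
    Tendsto (fun n => ∑ i ∈ Finset.range n, w i) atTop atTop := by
  refine (not_summable_iff_tendsto_nat_atTop_of_nonneg fun i => (hw.pos i).le).1 fun hs => ?_
  have := hw.infinite
  rw [← ENNReal.ofReal_tsum_of_nonneg (fun i => (hw.pos i).le) hs] at this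
  exact ENNReal.ofReal_ne_top this

/-- A sequence of non-negative numbers tending to zero can be enumerated in decreasing order,
with all of its support (but possibly not all its zeros) enumerated. -/
lemma exists_decreasing_enumeration {y : ℕ → ℝ} (hy : ∀ j, 0 ≤ y j)
    (hfin : ∀ ε > 0, {j | ε ≤ y j}.Finite) :
    ∃ σ : ℕ → ℕ, Function.Injective σ ∧ Antitone (fun i => y (σ i)) ∧
      ∀ j ∉ range σ, y j = 0 := by
  -- greedy choice of the largest remaining term
  have hmax : ∀ S : Finset ℕ, ∃ j, j ∉ S ∧ ∀ i, i ∉ S → y i ≤ y j := fun S => by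
    by_cases h : ∃ j, j ∉ S ∧ 0 < y j
    · obtain ⟨j, hjS, hj⟩ := h
      have hf := (hfin (y j) hj).subset (show {i | y j ≤ y i ∧ i ∉ S} ⊆ _ from fun i hi => hi.1)
      obtain ⟨k, hk, hkmax⟩ := Set.exists_max_image _ y hf ⟨j, le_rfl, hjS⟩
      refine ⟨k, hk.2, fun i hi => ?_⟩
      rcases le_total (y j) (y i) with h1 | h1
      · exact hkmax i ⟨h1, hi⟩
      · exact h1.trans hk.1
    · push Not at h
      obtain ⟨j, hj⟩ := Infinite.exists_notMem_finset S
      exact ⟨j, hj, fun i hi => (h i hi).trans (hy j)⟩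
  choose g hg1 hg2 using hmax
  let T : ℕ → Finset ℕ := fun n => Nat.rec ∅ (fun _ S => insert (g S) S) n
  have hTs : ∀ n, T (n + 1) = insert (g (T n)) (T n) := fun n => rfl
  have hTmono : Monotone T := monotone_nat_of_le_succ fun n => by
    rw [hTs]; exact Finset.subset_insert _ _
  have hmem : ∀ m n, m < n → g (T m) ∈ T n := fun m n h =>
    hTmono (Nat.succ_le_of_lt h) (by rw [hTs]; exact Finset.mem_insert_self _ _)
  have hTrange : ∀ n j, j ∈ T n → ∃ m, g (T m) = j := fun n => by
    induction n with
    | zero => intro j hj; exact absurd hj (Finset.notMem_empty j)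
    | succ n ih =>
      intro j hj
      rw [hTs, Finset.mem_insert] at hj
      rcases hj with rfl | hj
      · exact ⟨n, rfl⟩
      · exact ih j hj
  have hinj : Function.Injective fun n => g (T n) := by
    intro m n hmn
    have hmn : g (T m) = g (T n) := hmn
    rcases lt_trichotomy m n with h | h | h
    · exact absurd (show g (T n) ∈ T n from hmn ▸ hmem m n h) (hg1 _)
    · exact h
    · exact absurd (show g (T m) ∈ T m from hmn ▸ hmem n m h) (hg1 _)
  refine ⟨fun n => g (T n), hinj,
    fun m n hmn => hg2 _ _ fun h => hg1 (T n) (hTmono hmn h), fun j hj => ?_⟩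
  by_contra hne
  have hpos : 0 < y j := (hy j).lt_of_ne' hne
  have hsub : range (fun n => g (T n)) ⊆ {i | y j ≤ y i} := by
    rintro _ ⟨n, rfl⟩
    refine hg2 (T n) j fun hjn => hj ?_
    obtain ⟨m, hm⟩ := hTrange n j hjn
    exact ⟨m, hm⟩
  exact (infinite_range_of_injective hinj) ((hfin _ hpos).subset hsub)

end OrliczLorentz

/-! ### The sequence case -/

namespace OrliczLorentz

variable {φ : ℝ → ℝ} {w x : ℕ → ℝ}

lemma SeqSubmaj.sum_le (hw : IsSeqWeight w) {u : ℕ → ℝ} (h : SeqSubmaj u w) (S : Finset ℕ) :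
    ∑ j ∈ S, ENNReal.ofReal (u j) ≤ ENNReal.ofReal (∑ i ∈ Finset.range S.card, w i) :=
  (sum_le_sum_rearr u S).trans ((h S.card).trans (hw.sum_rearr _).le)

/-- If the sums of the largest terms of `|x|` do not become small compared with those of `w`,
then `p(x) = ∞`, by Young's inequality. -/
lemma seqP_eq_top (hφ : IsNFunction φ) (hw : IsSeqWeight w) {c : ℝ} (hc : 0 < c)
    (h : ∃ᶠ n in atTop, ∃ S : Finset ℕ, S.card = n ∧
      c * ∑ i ∈ Finset.range n, w i < ∑ j ∈ S, |x j|) :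
    seqP (complementary φ) w x = ∞ := by
  refine eq_top_iff.2 (le_iInf₂ fun u hu => ?_)
  rw [top_le_iff]
  by_contra hB
  set B := ∑' i, persp (complementary φ) |x i| (u i) with hBdef
  obtain ⟨t, ht0, ht⟩ := hφ.exists_lt_mul (half_pos hc)
  have hbig := hw.tendsto_sum.eventually_gt_atTop (B.toReal / (t * (c / 2)))
  obtain ⟨n, ⟨S, hS, hlt⟩, hn⟩ := (h.and_eventually hbig).exists
  rw [div_lt_iff₀ (by positivity)] at hn
  have hW0 : 0 ≤ ∑ i ∈ Finset.range n, w i := Finset.sum_nonneg fun i _ => (hw.pos i).le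
  have hsum : ENNReal.ofReal (t * ∑ j ∈ S, |x j|) ≤
      ENNReal.ofReal (B.toReal + φ t * ∑ i ∈ Finset.range n, w i) := by
    rw [ENNReal.ofReal_add ENNReal.toReal_nonneg (mul_nonneg (hφ.nonneg ht0.le) hW0),
      ENNReal.ofReal_toReal hB, ENNReal.ofReal_mul (hφ.nonneg ht0.le), Finset.mul_sum,
      ENNReal.ofReal_sum_of_nonneg fun i _ => mul_nonneg ht0.le (abs_nonneg _)]
    calc ∑ j ∈ S, ENNReal.ofReal (t * |x j|)
        ≤ ∑ j ∈ S, (persp (complementary φ) |x j| (u j) +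
            ENNReal.ofReal (φ t) * ENNReal.ofReal (u j)) :=
          Finset.sum_le_sum fun j _ => hφ.young_persp ht0.le (hu.1 j)
      _ = ∑ j ∈ S, persp (complementary φ) |x j| (u j) +
            ENNReal.ofReal (φ t) * ∑ j ∈ S, ENNReal.ofReal (u j) := by
          rw [Finset.sum_add_distrib, Finset.mul_sum]
      _ ≤ _ := by
          gcongr
          · exact ENNReal.sum_le_tsum S
          · exact hS ▸ hu.2.sum_le hw S
  rw [ENNReal.ofReal_le_ofReal_iff
    (add_nonneg ENNReal.toReal_nonneg (mul_nonneg (hφ.nonneg ht0.le) hW0))] at hsum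
  have h1 := mul_lt_mul_of_pos_left hlt ht0
  have h2 := mul_le_mul_of_nonneg_right ht.le hW0
  linarith

/-- The case of `seqP_eq_top`: the sequence `v = |x|` makes all sums infinite. -/
lemma exists_of_seqP_eq_top (hφ : IsNFunction φ) (hw : IsSeqWeight w) {c : ℝ} (hc : 0 < c)
    (h : ∃ᶠ n in atTop, ∃ S : Finset ℕ, S.card = n ∧
      c * ∑ i ∈ Finset.range n, w i < ∑ j ∈ S, |x j|) :
    ∃ v : ℕ → ℝ, (∀ i, 0 ≤ v i) ∧ (∀ i, v i = 0 ↔ x i = 0) ∧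
      seqP (complementary φ) w x = ∑' i, persp (complementary φ) |x i| (v i) ∧
      ∑' i, ENNReal.ofReal (φ (rightDeriv (complementary φ) (|x i| / v i)) * v i) =
        ∑' i : ℕ, extend φ (rearr Measure.count
          (fun j => rightDeriv (complementary φ) (|x j| / v j)) (i : ℝ≥0∞)) *
            ENNReal.ofReal (w i) := by
  set ψ := complementary φ with hψ
  set q := rightDeriv ψ with hq
  have hq1 : 0 < q 1 := hφ.rightDeriv_pos one_pos
  have hsum : ∑' i, ENNReal.ofReal |x i| = ∞ := by
    by_contra hne
    have hbig := hw.tendsto_sum.eventually_gt_atTop ((∑' i, ENNReal.ofReal |x i|).toReal / c)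
    obtain ⟨n, ⟨S, hS, hlt⟩, hn⟩ := (h.and_eventually hbig).exists
    rw [div_lt_iff₀ hc] at hn
    have h1 : ENNReal.ofReal (∑ j ∈ S, |x j|) ≤ ∑' i, ENNReal.ofReal |x i| := by
      rw [ENNReal.ofReal_sum_of_nonneg fun i _ => abs_nonneg _]
      exact ENNReal.sum_le_tsum S
    have h2 := (ENNReal.ofReal_le_iff_le_toReal hne).1 h1
    linarith
  have hinf : {i | x i ≠ 0}.Infinite := fun hf => by
    rw [tsum_eq_sum (s := hf.toFinset) fun i hi => by
      have : x i = 0 := by simpa using hi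
      simp [this]] at hsum
    exact ENNReal.sum_ne_top.2 (fun _ _ => ENNReal.ofReal_ne_top) hsum
  have hratio : ∀ i, x i ≠ 0 → |x i| / |x i| = 1 := fun i hi => div_self (abs_ne_zero.2 hi)
  refine ⟨fun i => |x i|, fun i => abs_nonneg _, fun i => abs_eq_zero, ?_, ?_⟩
  · rw [seqP_eq_top hφ hw hc h]
    have e : ∀ i, persp ψ |x i| |x i| = ENNReal.ofReal (ψ 1) * ENNReal.ofReal |x i| := fun i => by
      rw [← ENNReal.ofReal_mul (hφ.complementary_nonneg 1)]
      by_cases hi : x i = 0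
      · simp [hi, persp]
      · rw [persp, if_neg (abs_ne_zero.2 hi), hratio i hi]
    simp only [e, ENNReal.tsum_mul_left, hsum]
    exact (ENNReal.mul_top (by simpa using hφ.complementary_pos one_pos)).symm
  · have hF : ENNReal.ofReal (φ (q 1)) ≠ 0 := by simpa using hφ.pos _ hq1
    have e : ∀ i, ENNReal.ofReal (φ (q (|x i| / |x i|)) * |x i|) =
        ENNReal.ofReal (φ (q 1)) * ENNReal.ofReal |x i| := fun i => by
      rw [← ENNReal.ofReal_mul (hφ.nonneg hq1.le)]
      by_cases hi : x i = 0
      · simp [hi]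
      · rw [hratio i hi]
    have hr : ∀ i : ℕ, rearr Measure.count (fun j => q (|x j| / |x j|)) (i : ℝ≥0∞) =
        ENNReal.ofReal (q 1) := fun i => by
      refine le_antisymm (rearr_le fun r _ hlt => ?_) (le_rearr fun r _ hlt => ?_)
      · refine (measure_mono_null (fun j hj => ?_) measure_empty).le.trans (by simp)
        have hj : (r : ℝ) < |q (|x j| / |x j|)| := hj
        rw [abs_of_nonneg (hφ.rightDeriv_nonneg _)] at hj
        exact (hj.trans_le (hφ.rightDeriv_mono (div_self_le_one _))).not_gt hlt
      · have : distribution Measure.count (fun j => q (|x j| / |x j|)) r = ∞ := by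
          refine Measure.count_apply_infinite (hinf.mono fun j hj => ?_)
          change (r : ℝ) < |q (|x j| / |x j|)|
          rwa [hratio j hj, abs_of_nonneg hq1.le]
        rw [this]
        exact ENNReal.natCast_lt_top i
    simp only [e, hr, extend_ofReal hq1.le, ENNReal.tsum_mul_left, hsum, hw.infinite]

/-- The case in which the sums of the largest terms of `|x|` are small compared with those of
`w`: here `v` is the inverse level sequence of `w`. -/
lemma exists_of_eventually_le (hφ : IsNFunction φ) (hw : IsSeqWeight w)
    (h : ∀ c > 0, ∀ᶠ n in atTop, ∀ S : Finset ℕ, S.card = n →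
      ∑ j ∈ S, |x j| ≤ c * ∑ i ∈ Finset.range n, w i) :
    ∃ v : ℕ → ℝ, (∀ i, 0 ≤ v i) ∧ (∀ i, v i = 0 ↔ x i = 0) ∧
      seqP (complementary φ) w x = ∑' i, persp (complementary φ) |x i| (v i) ∧
      ∑' i, ENNReal.ofReal (φ (rightDeriv (complementary φ) (|x i| / v i)) * v i) =
        ∑' i : ℕ, extend φ (rearr Measure.count
          (fun j => rightDeriv (complementary φ) (|x j| / v j)) (i : ℝ≥0∞)) *
            ENNReal.ofReal (w i) := by
  have hfin : ∀ ε > 0, {j | ε ≤ |x j|}.Finite := fun ε hε => by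
    by_contra hinf
    have hw0 := hw.pos 0
    obtain ⟨n, hn, hn1⟩ := ((h (ε / (2 * w 0)) (by positivity)).and
      (eventually_ge_atTop 1)).exists
    obtain ⟨S, hS, hcard⟩ := Set.Infinite.exists_subset_card_eq hinf n
    have h1 : n * ε ≤ ∑ j ∈ S, |x j| := by
      rw [← hcard, ← nsmul_eq_mul]
      exact Finset.card_nsmul_le_sum _ _ _ fun j hj => hS hj
    have h2 : ∑ i ∈ Finset.range n, w i ≤ n * w 0 := by
      simpa using Finset.sum_le_card_nsmul (Finset.range n) w (w 0)
        fun i _ => hw.anti (Nat.zero_le i)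
    have h3 := hn S hcard
    have h4 : ε / (2 * w 0) * ∑ i ∈ Finset.range n, w i ≤ ε / (2 * w 0) * (n * w 0) :=
      mul_le_mul_of_nonneg_left h2 (by positivity)
    have h5 : ε / (2 * w 0) * (n * w 0) = n * ε / 2 := by field_simp
    have h6 : 0 < n * ε := by positivity
    linarith
  obtain ⟨σ, hσ, hanti, hoff⟩ := exists_decreasing_enumeration (fun j => abs_nonneg (x j)) hfin
  set η : ℕ → ℝ := fun i => |x (σ i)| with hη
  have hη0 : ∀ i, 0 ≤ η i := fun i => abs_nonneg _
  have hw0 : ∀ i, 0 ≤ w i := fun i => (hw.pos i).le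
  obtain ⟨r, hr⟩ := exists_isLevel hη0
    (fun i j hij hi => le_antisymm ((hanti hij).trans hi.le) (hη0 j)) hw.pos hw.tendsto_sum
    (fun c hc => (h c hc).mono fun n hn => by
      have := hn ((Finset.range n).image σ)
        (by rw [Finset.card_image_of_injective _ hσ, Finset.card_range])
      rwa [Finset.sum_image fun _ _ _ _ hab => hσ hab] at this)
  set v : ℕ → ℝ := Function.extend σ (fun i => η i / r i) 0 with hv
  have hvσ : ∀ i, v (σ i) = η i / r i := fun i => hσ.extend_apply _ _ i
  have hvoff : ∀ j ∉ range σ, v j = 0 := fun j hj =>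
    Function.extend_apply' _ _ j fun ⟨i, hi⟩ => hj ⟨i, hi⟩
  have hxoff : ∀ j ∉ range σ, x j = 0 := fun j hj => abs_eq_zero.1 (hoff j hj)
  have hv0 : ∀ j, 0 ≤ v j := fun j => by
    by_cases hj : j ∈ range σ
    · obtain ⟨i, rfl⟩ := hj
      rw [hvσ]; exact div_nonneg (hη0 i) (hr.nonneg i)
    · exact (hvoff j hj).ge
  have hratio : ∀ i, |x (σ i)| / v (σ i) = r i := fun i => by
    rw [hvσ]
    by_cases h0 : r i = 0
    · simp [h0]
    · exact div_div_cancel₀ (mt (hr.eq_zero_iff i).2 h0)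
  have htsum : ∀ f : ℕ → ℝ≥0∞, (∀ j ∉ range σ, f j = 0) → ∑' j, f j = ∑' i, f (σ i) :=
    fun f hf => (hσ.tsum_eq fun j hj => by_contra fun hjr => hj (hf j hjr)).symm
  have hvanti : Antitone fun i => v (σ i) := antitone_nat_of_succ_le fun i => by
    simp only [hvσ]
    exact hr.div_succ_le (a := fun _ => 1) (fun i => (mul_one _).symm) (hη0 i)
      (hanti (Nat.le_succ i)) one_pos one_pos (by simpa using hw.anti (Nat.le_succ i))
  have hsub : SeqSubmaj v w := fun n => by
    rw [hw.sum_rearr, Finset.sum_congr rfl fun i _ =>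
      rearr_count_of_injective hσ hv0 hvanti hvoff i,
      ← ENNReal.ofReal_sum_of_nonneg fun i _ => hv0 _]
    simp only [hvσ]
    exact ENNReal.ofReal_le_ofReal (hr.sum_div_le n)
  have hval : ∑' j, persp (complementary φ) |x j| (v j) =
      ∑' i, ENNReal.ofReal (complementary φ (r i) * (η i / r i)) := by
    rw [htsum _ fun j hj => by rw [hxoff j hj, hvoff j hj, abs_zero, persp_zero_zero]]
    exact tsum_congr fun i => by rw [hvσ, persp_div _ (hr.eq_zero_iff i).symm]
  refine ⟨v, hv0, fun j => ?_, le_antisymm (iInf₂_le v ⟨hv0, hsub⟩) ?_, ?_⟩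
  · by_cases hj : j ∈ range σ
    · obtain ⟨i, rfl⟩ := hj
      have : η i = 0 ↔ x (σ i) = 0 := abs_eq_zero
      rw [hvσ, div_eq_zero_iff, hr.eq_zero_iff, or_self, this]
    · simp [hvoff j hj, hxoff j hj]
  · rw [hval]
    refine le_iInf₂ fun u hu => ?_
    refine le_trans ?_ (ENNReal.tsum_comp_le_tsum_of_injective hσ _)
    refine hr.tsum_le_tsum hφ hη0 hw0 (u := fun i => ENNReal.ofReal (u (σ i))) (fun n => ?_)
      fun t ht i => hφ.young_persp ht (hu.1 _)
    have := hu.2.sum_le hw ((Finset.range n).image σ)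
    rwa [Finset.card_image_of_injective _ hσ, Finset.card_range,
      Finset.sum_image fun _ _ _ _ hab => hσ hab] at this
  · set q := rightDeriv (complementary φ)
    have hq0 : ∀ s, 0 ≤ q s := hφ.rightDeriv_nonneg
    have hFz : φ (q 0) = 0 := by rw [show q 0 = 0 from hφ.rightDeriv_zero, hφ.map_zero]
    have hre : ∀ i : ℕ, rearr Measure.count (fun j => q (|x j| / v j)) (i : ℝ≥0∞) =
        ENNReal.ofReal (q (r i)) := fun i => by
      rw [rearr_count_of_injective hσ (fun j => hq0 _) ?_ ?_ i, hratio]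
      · intro i j hij
        simp only [hratio]
        exact hφ.rightDeriv_mono (hr.anti hij)
      · intro j hj
        rw [hxoff j hj, abs_zero, zero_div]
        exact hφ.rightDeriv_zero
    rw [htsum _ fun j hj => by rw [hvoff j hj, mul_zero, ENNReal.ofReal_zero]]
    simp only [hratio]
    simp only [hvσ, hre, extend_ofReal (hq0 _), ← ENNReal.ofReal_mul (hφ.nonneg (hq0 _))]
    exact hr.tsum_mul_div_eq hη0 hw0 hFz fun s => hφ.nonneg (hq0 s)

/-- The two cases are separated by whether the sums of the `n` largest terms of `|x|` are
`o(w 0 + ⋯ + w (n - 1))`; if they are not, then no level sequence need exist and `p(x) = ∞`. -/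
theorem exists_optimal_seq (hφ : IsNFunction φ) (hw : IsSeqWeight w) (x : ℕ → ℝ) :
    ∃ v : ℕ → ℝ, (∀ i, 0 ≤ v i) ∧ (∀ i, v i = 0 ↔ x i = 0) ∧
      seqP (complementary φ) w x = ∑' i, persp (complementary φ) |x i| (v i) ∧
      ∑' i, ENNReal.ofReal (φ (rightDeriv (complementary φ) (|x i| / v i)) * v i) =
        ∑' i : ℕ, extend φ (rearr Measure.count
          (fun j => rightDeriv (complementary φ) (|x j| / v j)) (i : ℝ≥0∞)) *
            ENNReal.ofReal (w i) := by
  by_cases h : ∀ c > 0, ∀ᶠ n in atTop, ∀ S : Finset ℕ, S.card = n →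
      ∑ j ∈ S, |x j| ≤ c * ∑ i ∈ Finset.range n, w i
  · exact exists_of_eventually_le hφ hw h
  · push Not at h
    obtain ⟨c, hc, h⟩ := h
    exact exists_of_seqP_eq_top hφ hw hc h

end OrliczLorentz

/-! ### The Hardy–Littlewood inequality -/

namespace OrliczLorentz

lemma ofReal_le_volume_inter {T : ℝ} {d : ℝ≥0∞} {m : ℝ≥0∞} (h1 : m ≤ ENNReal.ofReal T)
    (h2 : m ≤ d) : m ≤ volume (Ioc 0 T ∩ {s | ENNReal.ofReal s < d}) := by
  have hm : m ≠ ∞ := ne_top_of_le_ne_top ENNReal.ofReal_ne_top h1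
  calc m = volume (Ioo 0 m.toReal) := by
        rw [Real.volume_Ioo, sub_zero, ENNReal.ofReal_toReal hm]
    _ ≤ _ := measure_mono fun s hs => by
        have hsm : ENNReal.ofReal s < m := (ENNReal.ofReal_lt_iff_lt_toReal hs.1.le hm).2 hs.2
        have hsT := (ENNReal.ofReal_lt_ofReal_iff_of_nonneg hs.1.le).1 (hsm.trans_le h1)
        exact ⟨⟨hs.1, hsT.le⟩, hsm.trans_le h2⟩

/-- The Hardy–Littlewood inequality: the integral of `u` over `E` is at most that of `u^*` over
`(0, μ E)`. By the layer cake formula and Tonelli's theorem, both reduce to the region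
`{(r, s) : s < d_u(r)}`. -/
lemma setLIntegral_le_setLIntegral_rearr {α : Type*} [MeasurableSpace α] {μ : Measure α}
    {u : α → ℝ} (hu : AEMeasurable u μ) (hu0 : 0 ≤ᵐ[μ] u) {E : Set α} {T : ℝ}
    (hE : μ E ≤ ENNReal.ofReal T) :
    ∫⁻ x in E, ENNReal.ofReal (u x) ∂μ ≤
      ∫⁻ s in Ioc 0 T, rearr μ u (ENNReal.ofReal s) := by
  rw [lintegral_eq_lintegral_meas_lt (μ.restrict E) (ae_restrict_of_ae hu0) hu.restrict]
  set D : ℝ → ℝ≥0∞ := fun t => distribution μ u t.toNNReal with hD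
  have hDanti : Antitone D := fun s t h => distribution_anti (Real.toNNReal_le_toNNReal h)
  have hmeas : MeasurableSet {p : ℝ × ℝ | ENNReal.ofReal p.2 < D p.1} :=
    measurableSet_lt (ENNReal.measurable_ofReal.comp measurable_snd)
      (hDanti.measurable.comp measurable_fst)
  have hm1 : ∀ t, MeasurableSet {s : ℝ | ENNReal.ofReal s < D t} := fun t =>
    hmeas.preimage measurable_prodMk_left
  have hm2 : ∀ s : ℝ, MeasurableSet {t : ℝ | ENNReal.ofReal s < D t} := fun s =>
    hmeas.preimage measurable_prodMk_right
  have hind : ∀ t s : ℝ, ({p : ℝ × ℝ | ENNReal.ofReal p.2 < D p.1}.indicator 1 (t, s) : ℝ≥0∞) =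
      {s : ℝ | ENNReal.ofReal s < D t}.indicator 1 s := fun t s => rfl
  have hind' : ∀ t s : ℝ, ({p : ℝ × ℝ | ENNReal.ofReal p.2 < D p.1}.indicator 1 (t, s) : ℝ≥0∞) =
      {t : ℝ | ENNReal.ofReal s < D t}.indicator 1 t := fun t s => rfl
  calc ∫⁻ t in Ioi 0, μ.restrict E {x | t < u x}
      ≤ ∫⁻ t in Ioi 0, ∫⁻ s in Ioc 0 T,
          {p : ℝ × ℝ | ENNReal.ofReal p.2 < D p.1}.indicator 1 (t, s) := by
        refine setLIntegral_mono' measurableSet_Ioi fun t ht => ?_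
        simp only [hind]
        rw [lintegral_indicator_one (hm1 t), Measure.restrict_apply (hm1 t), inter_comm]
        refine ofReal_le_volume_inter (((measure_mono (subset_univ _)).trans
          (Measure.restrict_apply_univ E).le).trans hE) ?_
        refine (Measure.restrict_le_self _).trans (measure_mono fun x hx => ?_)
        change ((t.toNNReal : ℝ≥0) : ℝ) < |u x|
        rw [Real.coe_toNNReal t (le_of_lt ht)]
        exact lt_of_lt_of_le hx (le_abs_self _)
    _ = ∫⁻ s in Ioc 0 T, ∫⁻ t in Ioi 0,
          {p : ℝ × ℝ | ENNReal.ofReal p.2 < D p.1}.indicator 1 (t, s) :=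
        lintegral_lintegral_swap (measurable_one.indicator hmeas).aemeasurable
    _ ≤ ∫⁻ s in Ioc 0 T, rearr μ u (ENNReal.ofReal s) := by
        refine lintegral_mono fun s => ?_
        simp only [hind']
        rw [lintegral_indicator_one (hm2 s), Measure.restrict_apply (hm2 s)]
        have hle : ∀ t, 0 < t → ENNReal.ofReal s < D t →
            ENNReal.ofReal t ≤ rearr μ u (ENNReal.ofReal s) := fun t ht hs =>
          le_iInf₂ fun r hr => by
            by_contra hlt
            have hrt : r ≤ t.toNNReal := by
              rw [not_le, ENNReal.ofReal] at hlt
              exact_mod_cast hlt.le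
            exact (hs.trans_le ((distribution_anti hrt).trans hr.2)).false
        rcases eq_or_ne (rearr μ u (ENNReal.ofReal s)) ∞ with htop | htop
        · rw [htop]; exact le_top
        calc volume ({t | ENNReal.ofReal s < D t} ∩ Ioi 0)
            ≤ volume (Ioc 0 (rearr μ u (ENNReal.ofReal s)).toReal) :=
              measure_mono fun t ht => ⟨ht.2, (ENNReal.ofReal_le_iff_le_toReal htop).1
                (hle t ht.2 ht.1)⟩
          _ = _ := by rw [Real.volume_Ioc, sub_zero, ENNReal.ofReal_toReal htop]

/-! ### Weights on an interval -/

section Weight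

variable {γ : ℝ≥0∞} {w : ℝ → ℝ}

lemma measurableSet_interval (γ : ℝ≥0∞) : MeasurableSet (interval γ) :=
  measurableSet_Ici.inter (measurableSet_lt ENNReal.measurable_ofReal measurable_const)

lemma mem_interval_of_lt {s T : ℝ} (hs : 0 ≤ s) (hsT : s < T) (hT : ENNReal.ofReal T ≤ γ) :
    s ∈ interval γ :=
  ⟨hs, ((ENNReal.ofReal_lt_ofReal_iff_of_nonneg hs).2 hsT).trans_le hT⟩

lemma leb_univ_le (γ : ℝ≥0∞) : leb γ univ ≤ γ := by
  rw [leb, Measure.restrict_apply_univ]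
  rcases eq_or_ne γ ∞ with rfl | hγ
  · exact le_top
  calc volume (interval γ) ≤ volume (Ico 0 γ.toReal) :=
        measure_mono fun t ht => ⟨ht.1, (ENNReal.ofReal_lt_iff_lt_toReal ht.1 hγ).1 ht.2⟩
    _ = γ := by rw [Real.volume_Ico, sub_zero, ENNReal.ofReal_toReal hγ]

lemma setLIntegral_Ioo_eq_Ioc (a b : ℝ) (f : ℝ → ℝ≥0∞) :
    ∫⁻ s in Ioo a b, f s = ∫⁻ s in Ioc a b, f s :=
  setLIntegral_congr Ioo_ae_eq_Ioc

lemma setLIntegral_Ioc_add_Ioc {a b c : ℝ} (hab : a ≤ b) (hbc : b ≤ c) (f : ℝ → ℝ≥0∞) :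
    (∫⁻ s in Ioc a b, f s) + ∫⁻ s in Ioc b c, f s = ∫⁻ s in Ioc a c, f s := by
  rw [← Ioc_union_Ioc_eq_Ioc hab hbc, lintegral_union measurableSet_Ioc
    (Ioc_disjoint_Ioc_of_le le_rfl)]

namespace IsWeight

lemma le_of_le (hw : IsWeight γ w) {s t : ℝ} (hs : 0 < s) (hst : s ≤ t) (ht : t ∈ interval γ) :
    w t ≤ w s :=
  hw.anti ⟨⟨hs.le, (ENNReal.ofReal_le_ofReal hst).trans_lt ht.2⟩, hs.ne'⟩
    ⟨ht, (hs.trans_le hst).ne'⟩ hst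

lemma rearr_le (hw : IsWeight γ w) {s : ℝ} (hs : 0 < s) :
    rearr (leb γ) w (ENNReal.ofReal s) ≤ ENNReal.ofReal (w s) := by
  refine OrliczLorentz.rearr_le fun r _ hr => ?_
  rw [distribution, leb, Measure.restrict_apply' (measurableSet_interval γ)]
  calc volume ({x | (r : ℝ) < |w x|} ∩ interval γ) ≤ volume (Ico 0 s) := by
        refine measure_mono fun x hx => ⟨hx.2.1, lt_of_not_ge fun hsx => ?_⟩
        have h1 : (r : ℝ) < |w x| := hx.1
        rw [abs_of_pos (hw.pos x hx.2)] at h1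
        have := hw.le_of_le hs hsx hx.2
        linarith
    _ = ENNReal.ofReal s := by rw [Real.volume_Ico, sub_zero]

lemma le_rearr_of_lt (hw : IsWeight γ w) {s t : ℝ} (hs : 0 < s) (hst : s < t)
    (ht : t ∈ interval γ) : ENNReal.ofReal (w t) ≤ rearr (leb γ) w (ENNReal.ofReal s) := by
  refine le_rearr fun r _ hr => ?_
  rw [distribution, leb, Measure.restrict_apply' (measurableSet_interval γ)]
  calc ENNReal.ofReal s < ENNReal.ofReal t := (ENNReal.ofReal_lt_ofReal_iff_of_nonneg hs.le).2 hst
    _ = volume (Ioc 0 t) := by rw [Real.volume_Ioc, sub_zero]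
    _ ≤ volume ({x | (r : ℝ) < |w x|} ∩ interval γ) := measure_mono fun x hx =>
        ⟨(hr.trans_le (hw.le_of_le hx.1 hx.2 ht)).trans_le (le_abs_self (w x)),
          hx.1.le, (ENNReal.ofReal_le_ofReal hx.2).trans_lt ht.2⟩

/-- A weight agrees with its decreasing rearrangement outside the countable set of its
discontinuities. -/
lemma ae_rearr_eq (hw : IsWeight γ w) :
    ∀ᵐ s, 0 < s → s ∈ interval γ →
      rearr (leb γ) w (ENNReal.ofReal s) = ENNReal.ofReal (w s) := by
  filter_upwards [hw.anti.countable_not_continuousWithinAt.ae_notMem volume] with s hs hs0 hsI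
  refine le_antisymm (hw.rearr_le hs0) ?_
  have hcont : ContinuousWithinAt w (interval γ \ {0}) s := by
    by_contra hc
    exact hs ⟨⟨hsI, hs0.ne'⟩, hc⟩
  obtain ⟨y, hsy, hy⟩ : ∃ y, s < y ∧ y ∈ interval γ := by
    obtain ⟨d, hd1, hd2⟩ := exists_between hsI.2
    have hdt : d ≠ ∞ := hd2.ne_top
    refine ⟨d.toReal, (ENNReal.ofReal_lt_iff_lt_toReal hs0.le hdt).1 hd1,
      ENNReal.toReal_nonneg, ?_⟩
    rwa [ENNReal.ofReal_toReal hdt]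
  have hsub : Ioo s y ⊆ interval γ \ {0} := fun x hx =>
    ⟨⟨(hs0.trans hx.1).le, (ENNReal.ofReal_le_ofReal hx.2.le).trans_lt hy.2⟩,
      (hs0.trans hx.1).ne'⟩
  have htend : Tendsto (fun t => ENNReal.ofReal (w t)) (𝓝[>] s) (𝓝 (ENNReal.ofReal (w s))) := by
    rw [← nhdsWithin_Ioo_eq_nhdsGT hsy]
    exact (ENNReal.continuous_ofReal.tendsto _).comp (hcont.mono hsub)
  refine le_of_tendsto htend ?_
  filter_upwards [Ioo_mem_nhdsGT hsy] with t ht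
  exact hw.le_rearr_of_lt hs0 ht.1 (hsub ht).1

lemma setLIntegral_rearr (hw : IsWeight γ w) {T : ℝ} (hT : ENNReal.ofReal T ≤ γ) :
    ∫⁻ s in Ioc 0 T, rearr (leb γ) w (ENNReal.ofReal s) =
      ∫⁻ s in Ioc 0 T, ENNReal.ofReal (w s) := by
  rw [← setLIntegral_Ioo_eq_Ioc, ← setLIntegral_Ioo_eq_Ioc]
  refine setLIntegral_congr_fun_ae measurableSet_Ioo ?_
  filter_upwards [hw.ae_rearr_eq] with s hs hsT
  exact hs hsT.1 (mem_interval_of_lt hsT.1.le hsT.2 hT)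

lemma mul_le_setLIntegral (hw : IsWeight γ w) {a b y : ℝ} (ha : 0 ≤ a) (hby : b ≤ y)
    (hy : y ∈ interval γ) :
    ENNReal.ofReal (w y) * ENNReal.ofReal (b - a) ≤ ∫⁻ s in Ioc a b, ENNReal.ofReal (w s) := by
  rw [← Real.volume_Ioc, ← setLIntegral_const]
  exact setLIntegral_mono' measurableSet_Ioc fun s hs =>
    ENNReal.ofReal_le_ofReal (hw.le_of_le (ha.trans_lt hs.1) (hs.2.trans hby) hy)

lemma setLIntegral_le_mul (hw : IsWeight γ w) {a b y : ℝ} (hy : 0 < y) (hya : y ≤ a)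
    (hb : ENNReal.ofReal b ≤ γ) :
    ∫⁻ s in Ioc a b, ENNReal.ofReal (w s) ≤ ENNReal.ofReal (w y) * ENNReal.ofReal (b - a) := by
  rw [← Real.volume_Ioo, ← setLIntegral_const, ← setLIntegral_Ioo_eq_Ioc]
  exact setLIntegral_mono' measurableSet_Ioo fun s hs =>
    ENNReal.ofReal_le_ofReal (hw.le_of_le hy (hya.trans hs.1.le)
      (mem_interval_of_lt (hy.le.trans (hya.trans hs.1.le)) hs.2 hb))

/-- The integral of a weight is finite up to and including the right end of `I`, if finite. -/
lemma setLIntegral_lt_top (hw : IsWeight γ w) {T : ℝ} (hT : ENNReal.ofReal T ≤ γ) :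
    ∫⁻ s in Ioc 0 T, ENNReal.ofReal (w s) < ∞ := by
  rcases le_or_gt T 0 with h0 | h0
  · simp [Ioc_eq_empty_of_le h0]
  rw [← setLIntegral_Ioc_add_Ioc (b := T / 2) (c := T) (by positivity) (by linarith)]
  exact ENNReal.add_lt_top.2
    ⟨hw.finite _ (mem_interval_of_lt (by positivity) (by linarith) hT),
      (hw.setLIntegral_le_mul (by positivity) le_rfl hT).trans_lt
        (ENNReal.mul_lt_top ENNReal.ofReal_lt_top ENNReal.ofReal_lt_top)⟩

lemma setLIntegral_pos (hw : IsWeight γ w) {a b : ℝ} (ha : 0 ≤ a) (hab : a < b)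
    (hb : ENNReal.ofReal b ≤ γ) : 0 < ∫⁻ s in Ioc a b, ENNReal.ofReal (w s) := by
  have hI : (a + b) / 2 ∈ interval γ := mem_interval_of_lt (by linarith) (by linarith) hb
  refine lt_of_lt_of_le ?_ (lintegral_mono_set
    (Ioc_subset_Ioc_right (show (a + b) / 2 ≤ b by linarith)))
  refine lt_of_lt_of_le ?_ (hw.mul_le_setLIntegral ha le_rfl hI)
  exact ENNReal.mul_pos (by simpa using hw.pos _ hI) (by simp; linarith)

end IsWeight

lemma Submaj.setLIntegral_rearr_le (hw : IsWeight γ w) {u : ℝ → ℝ} (h : Submaj γ u w) {T : ℝ}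
    (hT : ENNReal.ofReal T ≤ γ) :
    ∫⁻ s in Ioc 0 T, rearr (leb γ) u (ENNReal.ofReal s) ≤
      ∫⁻ s in Ioc 0 T, ENNReal.ofReal (w s) := by
  -- for `T = γ` this is a limit of the inequalities for smaller `T`
  have hlt : ∀ t < T, ∫⁻ s in Ioc 0 t, rearr (leb γ) u (ENNReal.ofReal s) ≤
      ∫⁻ s in Ioc 0 T, ENNReal.ofReal (w s) := fun t ht => by
    rcases le_or_gt 0 t with h0 | h0
    · have htI := mem_interval_of_lt h0 ht hT
      exact ((h t htI).trans (hw.setLIntegral_rearr htI.2.le).le).trans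
        (lintegral_mono_set (Ioc_subset_Ioc_right ht.le))
    · simp [Ioc_eq_empty_of_le h0.le]
  have hU : Ioo 0 T = ⋃ n : ℕ, Ioc 0 (T - 1 / ((n : ℝ) + 1)) := by
    ext x
    simp only [mem_Ioo, mem_iUnion, mem_Ioc]
    constructor
    · rintro ⟨h0, hx⟩
      obtain ⟨n, hn⟩ := exists_nat_one_div_lt (sub_pos.2 hx)
      exact ⟨n, h0, by linarith⟩
    · rintro ⟨n, h0, hx⟩
      have : (0 : ℝ) < 1 / ((n : ℝ) + 1) := by positivity
      exact ⟨h0, by linarith⟩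
  rw [← setLIntegral_Ioo_eq_Ioc, hU, setLIntegral_iUnion_of_directed]
  · refine iSup_le fun n => hlt _ ?_
    have : (0 : ℝ) < 1 / ((n : ℝ) + 1) := by positivity
    linarith
  · refine Monotone.directed_le fun m n hmn => Ioc_subset_Ioc_right ?_
    have := Nat.one_div_le_one_div (α := ℝ) hmn
    linarith

end Weight

end OrliczLorentz

/-! ### Layers of simple functions -/

namespace OrliczLorentz

/-- The positive values taken by a non-negative simple function on sets of positive measure,
in decreasing order: `c 0 > … > c (n - 1) > 0`, continued by zeros. -/
lemma IsSimple.exists_layers {γ : ℝ≥0∞} {h : ℝ → ℝ} (hs : IsSimple γ h)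
    (h0 : ∀ t ∈ interval γ, 0 ≤ h t) :
    ∃ (n : ℕ) (c : ℕ → ℝ), (∀ k, k < n → 0 < c k) ∧ (∀ k, n ≤ k → c k = 0) ∧
      (∀ i j, i < j → j < n → c j < c i) ∧ (∀ k, k < n → 0 < leb γ (h ⁻¹' {c k})) ∧
      ∀ᵐ t ∂leb γ, h t = 0 ∨ ∃ k < n, h t = c k := by
  classical
  set G : Finset ℝ := hs.2.toFinset.filter fun y => 0 < y ∧ 0 < leb γ (h ⁻¹' {y}) with hG
  set e := G.orderEmbOfFin rfl with he
  have hemem : ∀ i, e i ∈ G := fun i => G.orderEmbOfFin_mem rfl i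
  have hpos : ∀ y ∈ G, 0 < y ∧ 0 < leb γ (h ⁻¹' {y}) := fun y hy => (Finset.mem_filter.1 hy).2
  set c : ℕ → ℝ := fun k => if hk : k < G.card then e (Fin.rev ⟨k, hk⟩) else 0 with hc
  have hck : ∀ k (hk : k < G.card), c k = e (Fin.rev ⟨k, hk⟩) := fun k hk => dif_pos hk
  refine ⟨G.card, c, fun k hk => ?_, fun k hk => dif_neg (by omega), fun i j hij hj => ?_,
    fun k hk => ?_, ?_⟩
  · rw [hck k hk]; exact (hpos _ (hemem _)).1
  · rw [hck i (hij.trans hj), hck j hj]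
    exact e.strictMono (Fin.rev_lt_rev.2 hij)
  · rw [hck k hk]; exact (hpos _ (hemem _)).2
  · have hnull : ∀ᵐ t ∂leb γ, ∀ y ∈ hs.2.toFinset.filter fun y => ¬ 0 < leb γ (h ⁻¹' {y}),
        h t ≠ y := by
      refine (Finset.eventually_all _).2 fun y hy => ?_
      have := (Finset.mem_filter.1 hy).2
      rw [pos_iff_ne_zero, not_not] at this
      exact measure_eq_zero_iff_ae_notMem.1 this
    filter_upwards [hnull, ae_restrict_mem (measurableSet_interval γ)] with t ht htI
    rcases (h0 t htI).eq_or_lt with hz | hp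
    · exact Or.inl hz.symm
    right
    have hmem : h t ∈ G := by
      refine Finset.mem_filter.2 ⟨hs.2.mem_toFinset.2 ⟨t, htI, rfl⟩, hp, ?_⟩
      by_contra hz
      exact ht (h t) (Finset.mem_filter.2 ⟨hs.2.mem_toFinset.2 ⟨t, htI, rfl⟩, hz⟩) rfl
    have : h t ∈ range e := by rw [he, Finset.range_orderEmbOfFin]; exact hmem
    obtain ⟨i, hi⟩ := this
    refine ⟨(Fin.rev i : Fin _), (Fin.rev i).2, ?_⟩
    rw [hck _ (Fin.rev i).2, ← hi]
    exact congrArg e (Fin.rev_rev i).symm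

section Layers

variable {α : Type*} [MeasurableSpace α] {μ : Measure α} {A : ℕ → Set α}

lemma lintegral_eq_tsum_layers (hA : ∀ k, NullMeasurableSet (A k) μ)
    (hd : Pairwise (Function.onFun Disjoint A)) {Φ : α → ℝ≥0∞}
    (hΦ : ∀ᵐ x ∂μ, Φ x = 0 ∨ ∃ k, x ∈ A k) :
    ∫⁻ x, Φ x ∂μ = ∑' k, ∫⁻ x in A k, Φ x ∂μ := by
  rw [← lintegral_iUnion₀ hA fun i j hij => (hd hij).aedisjoint,
    ← lintegral_indicator₀ (NullMeasurableSet.iUnion hA)]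
  refine lintegral_congr_ae ?_
  filter_upwards [hΦ] with x hx
  by_cases h : x ∈ ⋃ k, A k
  · rw [indicator_of_mem h]
  · rw [indicator_of_notMem h]
    exact hx.resolve_right fun ⟨k, hk⟩ => h (mem_iUnion.2 ⟨k, hk⟩)

lemma tsum_layers_le_lintegral (hA : ∀ k, NullMeasurableSet (A k) μ)
    (hd : Pairwise (Function.onFun Disjoint A)) (Φ : α → ℝ≥0∞) :
    ∑' k, ∫⁻ x in A k, Φ x ∂μ ≤ ∫⁻ x, Φ x ∂μ := by
  rw [← lintegral_iUnion₀ hA fun i j hij => (hd hij).aedisjoint]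
  exact setLIntegral_le_lintegral _ _

lemma setLIntegral_layer {s : Set α} (hs : NullMeasurableSet s μ) {Φ : α → ℝ≥0∞} {b : ℝ≥0∞}
    (h : ∀ x ∈ s, Φ x = b) : ∫⁻ x in s, Φ x ∂μ = b * μ s := by
  rw [← setLIntegral_const]
  refine lintegral_congr_ae ?_
  filter_upwards [ae_restrict_mem₀ hs] with x hx
  exact h x hx

variable {t y : ℕ → ℝ} {f : α → ℝ}

lemma rearr_le_of_layers (hA : ∀ m, μ (⋃ i ∈ Finset.range m, A i) = ENNReal.ofReal (t m))
    (hf : ∀ i, ∀ x ∈ A i, f x = y i) (hf0 : ∀ᵐ x ∂μ, f x = 0 ∨ ∃ k, x ∈ A k)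
    (hy : Antitone y) (hy0 : ∀ i, 0 ≤ y i) {k : ℕ} {s : ℝ} (hs : t k ≤ s) :
    rearr μ f (ENNReal.ofReal s) ≤ ENNReal.ofReal (y k) := by
  refine rearr_le fun r _ hr => ?_
  calc distribution μ f r ≤ μ (⋃ i ∈ Finset.range k, A i) := by
        refine measure_mono_ae ?_
        filter_upwards [hf0] with x hx (hrx : (r : ℝ) < |f x|)
        rcases hx with hx | ⟨i, hi⟩
        · rw [hx, abs_zero] at hrx
          exact absurd hrx (not_lt.2 r.2)
        · rw [hf i x hi, abs_of_nonneg (hy0 i)] at hrx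
          have hik : i < k := by
            by_contra hle
            have := hy (not_lt.1 hle)
            linarith
          exact mem_biUnion (Finset.mem_coe.2 (Finset.mem_range.2 hik)) hi
    _ = ENNReal.ofReal (t k) := hA k
    _ ≤ _ := ENNReal.ofReal_le_ofReal hs

lemma rearr_eq_of_layers (hA : ∀ m, μ (⋃ i ∈ Finset.range m, A i) = ENNReal.ofReal (t m))
    (hf : ∀ i, ∀ x ∈ A i, f x = y i) (hf0 : ∀ᵐ x ∂μ, f x = 0 ∨ ∃ k, x ∈ A k)
    (hy : Antitone y) (hy0 : ∀ i, 0 ≤ y i) {k : ℕ} {s : ℝ} (hs0 : 0 ≤ s) (hs : t k ≤ s)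
    (hs' : s < t (k + 1)) : rearr μ f (ENNReal.ofReal s) = ENNReal.ofReal (y k) := by
  refine le_antisymm (rearr_le_of_layers hA hf hf0 hy hy0 hs) (le_rearr fun r _ hr => ?_)
  calc ENNReal.ofReal s < ENNReal.ofReal (t (k + 1)) :=
        (ENNReal.ofReal_lt_ofReal_iff_of_nonneg hs0).2 hs'
    _ = μ (⋃ i ∈ Finset.range (k + 1), A i) := (hA _).symm
    _ ≤ _ := measure_mono fun x hx => by
        obtain ⟨i, hi, hxi⟩ := mem_iUnion₂.1 hx
        have := hy (show i ≤ k by have := Finset.mem_range.1 hi; omega)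
        change (r : ℝ) < |f x|
        rw [hf i x hxi]
        exact (hr.trans_le this).trans_le (le_abs_self _)

end Layers

lemma sum_setLIntegral_Ioc {t : ℕ → ℝ} (ht : Monotone t) (ht0 : t 0 = 0) (f : ℝ → ℝ≥0∞) (m : ℕ) :
    ∑ i ∈ Finset.range m, ∫⁻ s in Ioc (t i) (t (i + 1)), f s = ∫⁻ s in Ioc 0 (t m), f s := by
  induction m with
  | zero => simp [ht0]
  | succ m ih =>
    rw [Finset.sum_range_succ, ih,
      setLIntegral_Ioc_add_Ioc (ht0 ▸ ht (Nat.zero_le m)) (ht (Nat.le_succ m))]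

/-- A decreasing step function whose integral is at most that of the weight at every step is
submajorized by it: between two steps `∫_0^T w` is concave in `T`. -/
lemma IsWeight.setLIntegral_step_le {γ : ℝ≥0∞} {w : ℝ → ℝ} (hw : IsWeight γ w) {n : ℕ}
    {t y : ℕ → ℝ} (ht : Monotone t) (ht0 : t 0 = 0) (htn : ENNReal.ofReal (t n) ≤ γ)
    {f : ℝ → ℝ≥0∞}
    (hf : ∀ k, k < n → ∀ s, t k < s → s < t (k + 1) → f s = ENNReal.ofReal (y k))
    (hfn : ∀ s, t n ≤ s → f s = 0) (hy0 : ∀ k, 0 ≤ y k)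
    (hle : ∀ m ≤ n, ∑ k ∈ Finset.range m, ENNReal.ofReal (y k * (t (k + 1) - t k)) ≤
      ∫⁻ s in Ioc 0 (t m), ENNReal.ofReal (w s))
    {T : ℝ} (hT : T ∈ interval γ) :
    ∫⁻ s in Ioc 0 T, f s ≤ ∫⁻ s in Ioc 0 T, ENNReal.ofReal (w s) := by
  have hconst : ∀ k, k < n → ∀ a b, t k ≤ a → b ≤ t (k + 1) →
      ∫⁻ s in Ioc a b, f s = ENNReal.ofReal (y k) * ENNReal.ofReal (b - a) := by
    intro k hk a b ha hb
    rw [← setLIntegral_Ioo_eq_Ioc, ← Real.volume_Ioo, ← setLIntegral_const]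
    exact setLIntegral_congr_fun measurableSet_Ioo fun s hs =>
      hf k hk s (ha.trans_lt hs.1) (hs.2.trans_le hb)
  have hstep : ∀ m ≤ n, ∫⁻ s in Ioc 0 (t m), f s ≤ ∫⁻ s in Ioc 0 (t m), ENNReal.ofReal (w s) := by
    intro m hm
    refine le_trans (le_of_eq ?_) (hle m hm)
    rw [← sum_setLIntegral_Ioc ht ht0]
    refine Finset.sum_congr rfl fun k hk => ?_
    have hk' := Finset.mem_range.1 hk
    rw [hconst k (by omega) _ _ le_rfl le_rfl, ENNReal.ofReal_mul (hy0 k)]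
  rcases le_or_gt (t n) T with h | h
  · have htn0 : 0 ≤ t n := ht0 ▸ ht (Nat.zero_le n)
    rw [← setLIntegral_Ioc_add_Ioc htn0 h, ← setLIntegral_Ioc_add_Ioc htn0 h]
    refine add_le_add (hstep n le_rfl) (le_trans (le_of_eq ?_) zero_le)
    exact setLIntegral_eq_zero measurableSet_Ioc fun s hs => hfn s hs.1.le
  rcases hT.1.eq_or_lt with h0 | h0
  · simp [← h0]
  obtain ⟨k, hk, hk1, hk2⟩ : ∃ k < n, t k ≤ T ∧ T < t (k + 1) := by
    classical
    have hex : ∃ j, T < t j := ⟨n, h⟩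
    obtain ⟨k, hk⟩ : ∃ k, Nat.find hex = k + 1 := Nat.exists_eq_succ_of_ne_zero fun hz => by
      have := Nat.find_spec hex
      rw [hz, ht0] at this
      linarith
    have hkn : Nat.find hex ≤ n := Nat.find_min' hex h
    exact ⟨k, by omega, not_lt.1 (Nat.find_min hex (by omega)), hk ▸ Nat.find_spec hex⟩
  have htk0 : 0 ≤ t k := ht0 ▸ ht (Nat.zero_le k)
  rcases le_total (y k) (w T) with hyw | hyw
  · rw [← setLIntegral_Ioc_add_Ioc htk0 hk1, ← setLIntegral_Ioc_add_Ioc htk0 hk1]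
    refine add_le_add (hstep k hk.le) ?_
    rw [hconst k hk _ _ le_rfl hk2.le]
    exact (mul_le_mul_left (ENNReal.ofReal_le_ofReal hyw) _).trans
      (hw.mul_le_setLIntegral htk0 le_rfl hT)
  · have hb : ENNReal.ofReal (t (k + 1)) ≤ γ := (ENNReal.ofReal_le_ofReal (ht hk)).trans htn
    have h1 := hstep (k + 1) hk
    rw [← setLIntegral_Ioc_add_Ioc h0.le hk2.le, ← setLIntegral_Ioc_add_Ioc h0.le hk2.le,
      hconst k hk _ _ hk1 le_rfl] at h1
    refine ENNReal.le_of_add_le_add_right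
      (a := ENNReal.ofReal (y k) * ENNReal.ofReal (t (k + 1) - T))
      (ENNReal.mul_ne_top ENNReal.ofReal_ne_top ENNReal.ofReal_ne_top) (h1.trans ?_)
    gcongr
    exact (hw.setLIntegral_le_mul h0 le_rfl hb).trans
      (mul_le_mul_left (ENNReal.ofReal_le_ofReal hyw) _)

end OrliczLorentz

/-! ### The function case -/

namespace OrliczLorentz

/-- A measurable function taking prescribed values at finitely many points, and `1` elsewhere. -/
lemma exists_measurable_interp {n : ℕ} {c : ℕ → ℝ} (hc : ∀ i j, i < j → j < n → c j < c i)
    (r : ℕ → ℝ) : ∃ ρ : ℝ → ℝ, Measurable ρ ∧ (∀ k, k < n → ρ (c k) = r k) ∧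
      ∀ x, (∀ k, k < n → x ≠ c k) → ρ x = 1 := by
  classical
  have hinj : ∀ i j, i < n → j < n → c i = c j → i = j := fun i j hi hj hij => by
    rcases lt_trichotomy i j with h | h | h
    · exact absurd hij (hc i j h hj).ne'
    · exact h
    · exact absurd hij (hc j i h hi).ne
  set ρ : ℝ → ℝ := fun x => if h : ∃ k, k < n ∧ x = c k then r h.choose else 1 with hρ
  have hρ1 : ∀ x, (∀ k, k < n → x ≠ c k) → ρ x = 1 := fun x hx =>
    dif_neg fun ⟨k, hk, hxk⟩ => hx k hk hxk
  refine ⟨ρ, ?_, fun k hk => ?_, hρ1⟩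
  · refine (measurable_const (a := (1 : ℝ))).measurable_of_countable_ne ?_
    refine ((Finset.range n).image c).countable_toSet.mono fun x hx => ?_
    by_contra hmem
    refine hx (hρ1 x fun k hk hxk => hmem ?_).symm
    exact Finset.mem_coe.2 (Finset.mem_image.2 ⟨k, Finset.mem_range.2 hk, hxk.symm⟩)
  · have h : ∃ j, j < n ∧ c k = c j := ⟨k, hk, rfl⟩
    have := hinj _ _ hk h.choose_spec.1 h.choose_spec.2
    rw [hρ]
    simp only [dif_pos h, ← this]

/-- For simple functions the level sequence is taken over the layers of `h`, with masses
`η k = ∫_{A k} h` and `ω k = ∫_{t k}^{t (k + 1)} w`, where `A k` is the layer occupying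
`[t k, t (k + 1))` after decreasing rearrangement of `h`. On `A k` then `v = h / r k`. -/
theorem exists_optimal_simple {φ : ℝ → ℝ} (hφ : IsNFunction φ) {γ : ℝ≥0∞} {w : ℝ → ℝ}
    (hw : IsWeight γ w) {h : ℝ → ℝ} (hs : IsSimple γ h) (h0 : ∀ t ∈ interval γ, 0 ≤ h t)
    (hfin : leb γ {t | h t ≠ 0} < ∞) :
    ∃ v : ℝ → ℝ, IsSimple γ v ∧ (∀ t ∈ interval γ, 0 ≤ v t) ∧
      (∀ t ∈ interval γ, v t = 0 ↔ h t = 0) ∧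
      P γ (complementary φ) w h = ∫⁻ t, persp (complementary φ) (h t) (v t) ∂(leb γ) ∧
      ∫⁻ t, ENNReal.ofReal (φ (rightDeriv (complementary φ) (h t / v t)) * v t) ∂(leb γ) =
        ∫⁻ t, extend φ (rearr (leb γ) (fun s => rightDeriv (complementary φ) (h s / v s))
          (ENNReal.ofReal t)) * ENNReal.ofReal (w t) ∂(leb γ) := by
  classical
  set μ := leb γ with hμ
  obtain ⟨n, c, hc, hcn, hcanti, hcμ, hae⟩ := hs.exists_layers h0
  have hc0 : ∀ k, 0 ≤ c k := fun k => by
    rcases lt_or_ge k n with hk | hk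
    · exact (hc k hk).le
    · exact (hcn k hk).ge
  -- the layers `A k`, their sizes `a k` and the total sizes `t k` of the first `k` of them
  set A : ℕ → Set ℝ := fun k => if k < n then h ⁻¹' {c k} else ∅ with hA
  have hAk : ∀ k, k < n → A k = h ⁻¹' {c k} := fun k hk => if_pos hk
  have hAn : ∀ k, n ≤ k → A k = ∅ := fun k hk => if_neg (by omega)
  have hhA : ∀ k, ∀ s ∈ A k, k < n ∧ h s = c k := fun k s hsk => by
    by_cases hk : k < n
    · rw [hAk k hk] at hsk; exact ⟨hk, hsk⟩
    · rw [hAn k (by omega)] at hsk; exact absurd hsk (notMem_empty s)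
  have hnull : ∀ k, NullMeasurableSet (A k) μ := fun k => by
    rcases lt_or_ge k n with hk | hk
    · rw [hAk k hk]; exact hs.1.nullMeasurable (measurableSet_singleton _)
    · rw [hAn k hk]; exact MeasurableSet.empty.nullMeasurableSet
  have hdisj : Pairwise (Function.onFun Disjoint A) := fun i j hij => by
    refine Set.disjoint_left.2 fun s hi hj => ?_
    obtain ⟨hin, hi⟩ := hhA i s hi
    obtain ⟨hjn, hj⟩ := hhA j s hj
    rcases lt_or_gt_of_ne hij with hlt | hlt
    · have := hcanti i j hlt hjn; linarith
    · have := hcanti j i hlt hin; linarith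
  have haeA : ∀ᵐ s ∂μ, h s = 0 ∨ ∃ k, s ∈ A k := by
    filter_upwards [hae] with s hs
    exact hs.imp_right fun ⟨k, hk, hsk⟩ => ⟨k, by rw [hAk k hk]; exact hsk⟩
  have hμA : ∀ k, μ (A k) ≠ ∞ := fun k => by
    refine ((measure_mono fun s hsk => ?_).trans_lt hfin).ne
    obtain ⟨hk, hsk⟩ := hhA k s hsk
    change h s ≠ 0
    rw [hsk]; exact (hc k hk).ne'
  set a : ℕ → ℝ := fun k => (μ (A k)).toReal with ha
  have ha0 : ∀ k, 0 ≤ a k := fun k => ENNReal.toReal_nonneg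
  have hapos : ∀ k, k < n → 0 < a k := fun k hk =>
    ENNReal.toReal_pos (by rw [hAk k hk]; exact (hcμ k hk).ne') (hμA k)
  have hofa : ∀ k, ENNReal.ofReal (a k) = μ (A k) := fun k => ENNReal.ofReal_toReal (hμA k)
  set t : ℕ → ℝ := fun k => ∑ i ∈ Finset.range k, a i with ht
  have ht0 : t 0 = 0 := by simp [ht]
  have hts : ∀ k, t (k + 1) = t k + a k := fun k => Finset.sum_range_succ _ _
  have htmono : Monotone t := monotone_nat_of_le_succ fun k => by
    have := hts k; have := ha0 k; linarith
  have htnonneg : ∀ k, 0 ≤ t k := fun k => ht0 ▸ htmono (Nat.zero_le k)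
  have hAt : ∀ m, μ (⋃ i ∈ Finset.range m, A i) = ENNReal.ofReal (t m) := fun m => by
    rw [measure_biUnion_finset₀ (fun i _ j _ hij => (hdisj hij).aedisjoint) fun i _ => hnull i,
      ht, ENNReal.ofReal_sum_of_nonneg fun i _ => ha0 i]
    exact Finset.sum_congr rfl fun i _ => (hofa i).symm
  have htγ : ∀ m, ENNReal.ofReal (t m) ≤ γ := fun m => by
    rw [← hAt]; exact (measure_mono (subset_univ _)).trans (leb_univ_le γ)
  -- the masses `η k` of `h` and `ω k` of `w`; the `ω k` with `k ≥ n` are immaterial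
  set η : ℕ → ℝ := fun k => c k * a k with hη
  have hη0 : ∀ k, 0 ≤ η k := fun k => mul_nonneg (hc0 k) (ha0 k)
  have hηn : ∀ k, n ≤ k → η k = 0 := fun k hk => by simp [hη, hcn k hk]
  have hηpos : ∀ k, k < n → 0 < η k := fun k hk => mul_pos (hc k hk) (hapos k hk)
  set I : ℕ → ℝ≥0∞ := fun k => ∫⁻ s in Ioc (t k) (t (k + 1)), ENNReal.ofReal (w s) with hI
  have hIfin : ∀ k, I k ≠ ∞ := fun k =>
    ((lintegral_mono_set (Ioc_subset_Ioc_left (htnonneg k))).trans_lt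
      (hw.setLIntegral_lt_top (htγ (k + 1)))).ne
  set ω : ℕ → ℝ := fun k => if k < n then (I k).toReal else 1 with hω
  have hωk : ∀ k, k < n → ENNReal.ofReal (ω k) = I k := fun k hk => by
    rw [hω]; simp only [if_pos hk]; exact ENNReal.ofReal_toReal (hIfin k)
  have hωpos : ∀ k, 0 < ω k := fun k => by
    rcases lt_or_ge k n with hk | hk
    · rw [hω]; simp only [if_pos hk]
      refine ENNReal.toReal_pos (hw.setLIntegral_pos (htnonneg k) ?_ (htγ _)).ne' (hIfin k)
      have := hts k; have := hapos k hk; linarith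
    · rw [hω]; simp only [if_neg (not_lt.2 hk)]; exact one_pos
  have hωsum : ∀ m ≤ n, ENNReal.ofReal (∑ k ∈ Finset.range m, ω k) =
      ∫⁻ s in Ioc 0 (t m), ENNReal.ofReal (w s) := fun m hm => by
    rw [← sum_setLIntegral_Ioc htmono ht0, ENNReal.ofReal_sum_of_nonneg fun i _ => (hωpos i).le]
    exact Finset.sum_congr rfl fun k hk => hωk k ((Finset.mem_range.1 hk).trans_le hm)
  have hωtend : Tendsto (fun m => ∑ i ∈ Finset.range m, ω i) atTop atTop := by
    refine (not_summable_iff_tendsto_nat_atTop_of_nonneg fun i => (hωpos i).le).1 fun hsum => ?_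
    have h1 : Tendsto ω atTop (𝓝 1) := tendsto_const_nhds.congr' <|
      (eventually_ge_atTop n).mono fun k hk => by simp [hω, not_lt.2 hk]
    exact one_ne_zero (tendsto_nhds_unique h1 hsum.tendsto_atTop_zero)
  have hηsum : ∀ m, n ≤ m → ∑ i ∈ Finset.range m, η i = ∑ i ∈ Finset.range n, η i := fun m hm =>
    (Finset.sum_subset (Finset.range_mono hm) fun i _ hi =>
      hηn i (not_lt.1 fun h => hi (Finset.mem_range.2 h))).symm
  obtain ⟨r, hr⟩ := exists_isLevel hη0
    (fun i j hij hi => hηn j (by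
      by_contra hlt
      exact (hηpos i (by omega)).ne' hi)) hωpos hωtend
    (fun ε hε => by
      filter_upwards [eventually_ge_atTop n,
        hωtend.eventually_ge_atTop ((∑ i ∈ Finset.range n, η i) / ε)] with m hm hm'
      rw [hηsum m hm]
      rwa [div_le_iff₀' hε] at hm')
  have hrpos : ∀ k, k < n → 0 < r k := fun k hk =>
    (hr.nonneg k).lt_of_ne' fun hz => (hηpos k hk).ne' ((hr.eq_zero_iff k).1 hz)
  have hrn : ∀ k, n ≤ k → r k = 0 := fun k hk => (hr.eq_zero_iff k).2 (hηn k hk)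
  -- the inverse level function `v` of `w` has the value `y k = c k / r k` on `A k`
  obtain ⟨ρ, hρm, hρc, hρ1⟩ := exists_measurable_interp hcanti r
  have hρpos : ∀ x, 0 < ρ x := fun x => by
    by_cases hx : ∃ k, k < n ∧ x = c k
    · obtain ⟨k, hk, rfl⟩ := hx
      rw [hρc k hk]; exact hrpos k hk
    · rw [hρ1 x fun k hk hxk => hx ⟨k, hk, hxk⟩]; exact one_pos
  set y : ℕ → ℝ := fun k => c k / r k with hy
  have hy0 : ∀ k, 0 ≤ y k := fun k => div_nonneg (hc0 k) (hr.nonneg k)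
  have hyn : ∀ k, n ≤ k → y k = 0 := fun k hk => by simp [hy, hcn k hk]
  have hya : ∀ k, y k * a k = η k / r k := fun k => by simp only [hy, hη]; ring
  set v : ℝ → ℝ := fun s => h s / ρ (h s) with hv
  have hvA : ∀ k, ∀ s ∈ A k, v s = y k := fun k s hsk => by
    obtain ⟨hk, hsk⟩ := hhA k s hsk
    simp only [hv, hy, hsk, hρc k hk]
  have hv0 : ∀ s ∈ interval γ, 0 ≤ v s := fun s hs => div_nonneg (h0 s hs) (hρpos _).le
  have hvz : ∀ s, v s = 0 ↔ h s = 0 := fun s => by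
    simp only [hv, div_eq_zero_iff, (hρpos (h s)).ne', or_false]
  have hvae : ∀ᵐ s ∂μ, v s = 0 ∨ ∃ k, s ∈ A k := haeA.mono fun s hs => hs.imp_left (hvz s).2
  have hvs : IsSimple γ v := by
    refine ⟨hs.1.div (hρm.comp_aemeasurable hs.1), (hs.2.image fun x => x / ρ x).subset ?_⟩
    rintro _ ⟨s, hsI, rfl⟩
    exact ⟨h s, ⟨s, hsI, rfl⟩, rfl⟩
  have hratio : ∀ s, v s ≠ 0 → h s / v s = ρ (h s) := fun s hs =>
    div_div_cancel₀ (mt (hvz s).2 hs)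
  have hratioA : ∀ k, ∀ s ∈ A k, h s / v s = r k := fun k s hsk => by
    obtain ⟨hk, hhs⟩ := hhA k s hsk
    rw [hratio s (mt (hvz s).1 (by rw [hhs]; exact (hc k hk).ne')), hhs, hρc k hk]
  have hyanti : Antitone y := antitone_nat_of_succ_le fun k => by
    rcases lt_or_ge (k + 1) n with hk | hk
    · have hk0 : k < n := by omega
      have h1 := hapos k hk0
      have h2 := hapos (k + 1) hk
      -- both averages are compared with the value of `w` between the two layers
      have hmem : t (k + 1) ∈ interval γ :=
        mem_interval_of_lt (htnonneg _) (by rw [hts (k + 1)]; linarith) (htγ (k + 1 + 1))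
      have hpos : 0 < t (k + 1) := by have := hts k; have := htnonneg k; linarith
      have hwt := (hw.pos _ hmem).le
      have hub : ω (k + 1) ≤ w (t (k + 1)) * a (k + 1) := by
        have := hw.setLIntegral_le_mul hpos le_rfl (htγ (k + 1 + 1))
        rw [show t (k + 1 + 1) - t (k + 1) = a (k + 1) by rw [hts (k + 1)]; ring,
          ← ENNReal.ofReal_mul hwt] at this
        exact (ENNReal.ofReal_le_ofReal_iff (by positivity)).1 ((hωk _ hk).le.trans this)
      have hlb : w (t (k + 1)) * a k ≤ ω k := by
        have := hw.mul_le_setLIntegral (htnonneg k) le_rfl hmem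
        rw [show t (k + 1) - t k = a k by rw [hts k]; ring, ← ENNReal.ofReal_mul hwt] at this
        exact (ENNReal.ofReal_le_ofReal_iff (hωpos k).le).1 (this.trans (hωk _ hk0).ge)
      exact hr.div_succ_le (fun i => rfl) (hc0 k) (hcanti k (k + 1) (Nat.lt_succ_self k) hk).le
        h1 h2 (((div_le_iff₀ h2).2 hub).trans ((le_div_iff₀ h1).2 hlb))
    · rw [hyn _ hk]; exact hy0 k
  have hsub : Submaj γ v w := fun T hT => by
    rw [hw.setLIntegral_rearr hT.2.le]
    refine hw.setLIntegral_step_le htmono ht0 (htγ n) (y := y) (fun k hk s hs1 hs2 => ?_)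
      (fun s hs1 => ?_) hy0 (fun m hm => ?_) hT
    · exact rearr_eq_of_layers hAt hvA hvae hyanti hy0 ((htnonneg k).trans hs1.le) hs1.le hs2
    · have := rearr_le_of_layers hAt hvA hvae hyanti hy0 hs1
      rw [hyn n le_rfl, ENNReal.ofReal_zero] at this
      exact le_antisymm this zero_le
    · rw [← hωsum m hm, ← ENNReal.ofReal_sum_of_nonneg fun k _ =>
        mul_nonneg (hy0 k) (by have := hts k; have := ha0 k; linarith)]
      refine ENNReal.ofReal_le_ofReal (le_trans (le_of_eq ?_) (hr.sum_div_le m))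
      exact Finset.sum_congr rfl fun k _ => by rw [hts k, add_sub_cancel_left, hya]
  have hval : ∫⁻ s, persp (complementary φ) (h s) (v s) ∂μ =
      ∑' k, ENNReal.ofReal (complementary φ (r k) * (η k / r k)) := by
    rw [lintegral_eq_tsum_layers hnull hdisj (haeA.mono fun s hs => hs.imp_left fun hz => by
      rw [hz, (hvz s).2 hz, persp_zero_zero])]
    refine tsum_congr fun k => ?_
    rcases lt_or_ge k n with hk | hk
    · rw [setLIntegral_layer (hnull k) fun s hsk => by
        rw [hvA k s hsk, (hhA k s hsk).2, persp_div (complementary φ)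
          (iff_of_false (hc k hk).ne' (hrpos k hk).ne')], ← hofa, ← ENNReal.ofReal_mul
          (mul_nonneg (hφ.complementary_nonneg _) (hy0 k)), mul_assoc, ← hya]
    · simp [hAn k hk, hηn k hk]
  refine ⟨v, hvs, hv0, fun s _ => hvz s, ?_, ?_⟩
  · have habs : ∀ u : ℝ → ℝ, ∫⁻ s, persp (complementary φ) |h s| (u s) ∂μ =
        ∫⁻ s, persp (complementary φ) (h s) (u s) ∂μ := fun u =>
      setLIntegral_congr_fun (measurableSet_interval γ) fun s hs => by
        simp only [abs_of_nonneg (h0 s hs)]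
    refine le_antisymm ((iInf₂_le v ⟨hvs.1, hv0, hsub⟩).trans (habs v).le) ?_
    rw [hval]
    refine le_iInf₂ fun u hu => ?_
    rw [habs]
    have hu0 : ∀ᵐ s ∂μ, 0 ≤ u s :=
      (ae_restrict_mem (measurableSet_interval γ)).mono fun s hs => hu.2.1 s hs
    refine le_trans ?_ (tsum_layers_le_lintegral hnull hdisj _)
    refine hr.tsum_le_tsum hφ hη0 (fun k => (hωpos k).le)
      (u := fun k => ∫⁻ s in A k, ENNReal.ofReal (u s) ∂μ) (fun m => ?_) fun x hx k => ?_
    · have hle : ∀ m ≤ n, ∑ k ∈ Finset.range m, ∫⁻ s in A k, ENNReal.ofReal (u s) ∂μ ≤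
          ENNReal.ofReal (∑ k ∈ Finset.range m, ω k) := fun m hm => by
        rw [hωsum m hm, ← lintegral_biUnion_finset₀
          (fun i _ j _ hij => (hdisj hij).aedisjoint) fun i _ => hnull i]
        exact (setLIntegral_le_setLIntegral_rearr hu.1 hu0 (hAt m).le).trans
          (hu.2.2.setLIntegral_rearr_le hw (htγ m))
      rcases le_total m n with hm | hm
      · exact hle m hm
      · rw [← Finset.sum_subset (Finset.range_mono hm) fun i _ hi => by
          rw [hAn i (not_lt.1 fun h => hi (Finset.mem_range.2 h)), Measure.restrict_empty,
            lintegral_zero_measure]]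
        exact (hle n le_rfl).trans (ENNReal.ofReal_le_ofReal
          (Finset.sum_le_sum_of_subset_of_nonneg (Finset.range_mono hm) fun i _ _ => (hωpos i).le))
    · calc ENNReal.ofReal (x * η k) = ∫⁻ s in A k, ENNReal.ofReal (x * h s) ∂μ := by
            rw [setLIntegral_layer (hnull k) fun s hsk => by rw [(hhA k s hsk).2], ← hofa,
              ← ENNReal.ofReal_mul (mul_nonneg hx (hc0 k)), mul_assoc]
        _ ≤ ∫⁻ s in A k, (persp (complementary φ) (h s) (u s) +
              ENNReal.ofReal (φ x) * ENNReal.ofReal (u s)) ∂μ :=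
            lintegral_mono_ae ((ae_restrict_of_ae hu0).mono fun s hs => hφ.young_persp hx hs)
        _ = _ := by
            rw [lintegral_add_right' _ (hu.1.ennreal_ofReal.restrict.const_mul _),
              lintegral_const_mul' _ _ ENNReal.ofReal_ne_top]
  · set q := rightDeriv (complementary φ) with hq
    have hq0 : ∀ s, 0 ≤ q s := hφ.rightDeriv_nonneg
    have hqz : q 0 = 0 := hφ.rightDeriv_zero
    have hFz : φ (q 0) = 0 := by rw [hqz, hφ.map_zero]
    have hF0 : ∀ s, 0 ≤ φ (q s) := fun s => hφ.nonneg (hq0 s)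
    have hqanti : Antitone fun k => q (r k) := fun i j hij => hφ.rightDeriv_mono (hr.anti hij)
    have hqA : ∀ k, ∀ s ∈ A k, q (h s / v s) = q (r k) := fun k s hsk => by
      rw [hratioA k s hsk]
    have hqae : ∀ᵐ s ∂μ, q (h s / v s) = 0 ∨ ∃ k, s ∈ A k := haeA.mono fun s hs =>
      hs.imp_left fun hz => by rw [hz, zero_div, hqz]
    have hlhs : ∫⁻ s, ENNReal.ofReal (φ (q (h s / v s)) * v s) ∂μ =
        ∑' k, ENNReal.ofReal (φ (q (r k)) * (η k / r k)) := by
      rw [lintegral_eq_tsum_layers hnull hdisj (hvae.mono fun s hs => hs.imp_left fun hz => by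
        rw [hz, mul_zero, ENNReal.ofReal_zero])]
      refine tsum_congr fun k => ?_
      rw [setLIntegral_layer (hnull k) fun s hsk => by rw [hratioA k s hsk, hvA k s hsk], ← hofa,
        ← ENNReal.ofReal_mul (mul_nonneg (hF0 _) (hy0 k)), mul_assoc, ← hya]
    rw [hlhs, hr.tsum_mul_div_eq hη0 (fun k => (hωpos k).le) hFz hF0]
    set Φ : ℝ → ℝ≥0∞ := fun s => extend φ (rearr μ (fun s => q (h s / v s)) (ENNReal.ofReal s)) *
      ENNReal.ofReal (w s) with hΦ
    have hΦk : ∀ k, k < n → ∫⁻ s in Ioc (t k) (t (k + 1)), Φ s =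
        ENNReal.ofReal (φ (q (r k)) * ω k) := fun k hk => by
      rw [ENNReal.ofReal_mul (hF0 _), hωk k hk, hI, ← lintegral_const_mul' _ _
        ENNReal.ofReal_ne_top, ← setLIntegral_Ioo_eq_Ioc, ← setLIntegral_Ioo_eq_Ioc]
      refine setLIntegral_congr_fun measurableSet_Ioo fun s hs => ?_
      simp only [hΦ]
      rw [rearr_eq_of_layers hAt hqA hqae hqanti (fun i => hq0 _) ((htnonneg k).trans hs.1.le)
        hs.1.le hs.2, extend_ofReal (hq0 _)]
    have hΦn : ∀ s, t n ≤ s → Φ s = 0 := fun s hs => by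
      have := rearr_le_of_layers hAt hqA hqae hqanti (fun i => hq0 _) hs
      rw [hrn n le_rfl, hqz, ENNReal.ofReal_zero] at this
      simp only [hΦ]
      rw [le_antisymm this zero_le, ← ENNReal.ofReal_zero, extend_ofReal le_rfl, hφ.map_zero,
        ENNReal.ofReal_zero, zero_mul]
    rw [tsum_eq_sum (s := Finset.range n) fun k hk => by
        rw [hrn k (not_lt.1 fun h => hk (Finset.mem_range.2 h)), hFz, zero_mul,
          ENNReal.ofReal_zero],
      ← Finset.sum_congr rfl fun k hk => hΦk k (Finset.mem_range.1 hk),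
      sum_setLIntegral_Ioc htmono ht0, ← setLIntegral_Ioo_eq_Ioc,
      ← lintegral_indicator measurableSet_Ioo, hμ, leb,
      ← lintegral_indicator (measurableSet_interval γ)]
    refine lintegral_congr_ae ?_
    filter_upwards [(countable_singleton (0 : ℝ)).ae_notMem volume] with s hs0
    by_cases hs : s ∈ Ioo 0 (t n)
    · rw [indicator_of_mem hs, indicator_of_mem (mem_interval_of_lt hs.1.le hs.2 (htγ n))]
    · rw [indicator_of_notMem hs]
      by_cases hsI : s ∈ interval γ
      · rw [indicator_of_mem hsI]
        refine (hΦn s ?_).symm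
        by_contra hlt
        exact hs ⟨hsI.1.lt_of_ne' hs0, not_le.1 hlt⟩
      · rw [indicator_of_notMem hsI]

end OrliczLorentz

/-! ### Inverse level functions as minimizers -/

theorem mainTheorem9 (φ : ℝ → ℝ) (hφ : OrliczLorentz.IsNFunction φ) :
    (∀ (γ : ℝ≥0∞) (w : ℝ → ℝ), 0 < γ → OrliczLorentz.IsWeight γ w →
      ∀ h : ℝ → ℝ, OrliczLorentz.IsSimple γ h → (∀ t ∈ OrliczLorentz.interval γ, 0 ≤ h t) →
        OrliczLorentz.leb γ {t | h t ≠ 0} < ∞ →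
        ∃ v : ℝ → ℝ, OrliczLorentz.IsSimple γ v ∧
          (∀ t ∈ OrliczLorentz.interval γ, 0 ≤ v t) ∧
          (∀ t ∈ OrliczLorentz.interval γ, v t = 0 ↔ h t = 0) ∧
          OrliczLorentz.P γ (OrliczLorentz.complementary φ) w h =
            ∫⁻ t, OrliczLorentz.persp (OrliczLorentz.complementary φ) (h t) (v t)
              ∂(OrliczLorentz.leb γ) ∧
          ∫⁻ t, ENNReal.ofReal
              (φ (OrliczLorentz.rightDeriv (OrliczLorentz.complementary φ) (h t / v t)) * v t)
              ∂(OrliczLorentz.leb γ) =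
            ∫⁻ t, OrliczLorentz.extend φ
              (OrliczLorentz.rearr (OrliczLorentz.leb γ)
                (fun s => OrliczLorentz.rightDeriv (OrliczLorentz.complementary φ) (h s / v s))
                (ENNReal.ofReal t)) * ENNReal.ofReal (w t) ∂(OrliczLorentz.leb γ)) ∧
    (∀ w : ℕ → ℝ, OrliczLorentz.IsSeqWeight w → ∀ x : ℕ → ℝ,
        ∃ v : ℕ → ℝ, (∀ i, 0 ≤ v i) ∧ (∀ i, v i = 0 ↔ x i = 0) ∧
          OrliczLorentz.seqP (OrliczLorentz.complementary φ) w x =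
            ∑' i, OrliczLorentz.persp (OrliczLorentz.complementary φ) |x i| (v i) ∧
          ∑' i, ENNReal.ofReal
              (φ (OrliczLorentz.rightDeriv (OrliczLorentz.complementary φ) (|x i| / v i)) * v i) =
            ∑' i : ℕ, OrliczLorentz.extend φ
              (OrliczLorentz.rearr Measure.count
                (fun j => OrliczLorentz.rightDeriv (OrliczLorentz.complementary φ) (|x j| / v j))
                (i : ℝ≥0∞)) * ENNReal.ofReal (w i)) :=
  ⟨fun _ _ _ hw _ hs h0 hfin => OrliczLorentz.exists_optimal_simple hφ hw hs h0 hfin,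
    fun _ hw x => OrliczLorentz.exists_optimal_seq hφ hw x⟩
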